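/- Let $M=2^a\ge 2$ be an integer power of two, let $n$ be a positive integer with $n\ge\log_2 M$, and let $m\ge\frac12$ and $\mathsf{SNR}\ge 0$ be real. Let $X$ be uniformly distributed on the $M$-PSK constellation $\mathcal C=\{e^{\jmath\pi(\frac{2k+1}{M}-1)}:0\le k\le M-1\}$, let $W\sim\mathcal{CN}(0,1)$ (density $\frac1\pi e^{-|w|^2}$ on $\mathbb C$), and let $H$ be a complex fading coefficient with circularly-symmetric distribution, unit power $\mathbb E|H|^2=1$ and Nakagami-$m$ magnitude, i.e. $|H|$ has density $\frac{2m^m}{\Gamma(m)}r^{2m-1}e^{-mr^2}$ on $r\ge 0$; $X,H,W$ are independent. Put $Y=\sqrt{\mathsf{SNR}}\,HX+W$ and let the $n$-bit quantizer be $Q(Y)=k$ if $\frac{2\pi}{2^n}k\le \operatorname{Arg}Y+\pi<\frac{2\pi}{2^n}(k+1)$, $k\in\{0,\dots,2^n-1\}$, where $\operatorname{Arg}$ takes values in $[-\pi,\pi)$. Let $\hat x(k,h)\in\arg\max_{x\in\mathcal C}\Pr(X=x\mid Q(Y)=k,H=h)$ be an optimum detector and $p(\mathsf{SNR})=\Pr(X\ne\hat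 x(Q(Y),H))$ its average symbol error probability. Let $\mathcal Q$ be the complementary distribution function of the standard normal law. Then $$p(\mathsf{SNR})=\begin{cases}p_1(\mathsf{SNR})+p_2(\mathsf{SNR})-p_3(\mathsf{SNR})+p_4(\mathsf{SNR}), & M\ge 4,\\ p_2(\mathsf{SNR}), & M=2,\end{cases}$$ where $$p_1(\mathsf{SNR})=\frac{2^{n-1}m^m}{\pi^2}\int_0^{\frac\pi2}\int_{\frac\pi M-\frac\pi{2^n}}^{\frac\pi M+\frac\pi{2^n}}\Big(\frac{\mathsf{SNR}}{\sin^2\beta}\cos^2\theta+m\Big)^{-m}d\theta\,d\beta,$$ $$p_2(\mathsf{SNR})=\frac{2^{n-1}m^m}{\pi^2}\int_0^{\frac\pi2}\int_{\frac\pi M-\frac\pi{2^n}}^{\frac\pi M+\frac\pi{2^n}}\Big(\frac{\mathsf{SNR}}{\sin^2\beta}\sin^2\theta+m\Big)^{-m}d\theta\,d\beta,$$ $$p_3(\mathsf{SNR})=\frac{2^{n-1}m^m}{\pi^3}\int_0^{\frac\pi2}\int_0^{\frac\pi2}\int_{\frac\pi M-\frac\pi{2^n}}^{\frac\pi M+\frac\pi{2^n}}\Big(\frac{\mathsf{SNR}\cos^2\theta}{\sin^2\beta}+\frac{\mathsf{SNR}\sin^2\theta}{\sin^2\gamma}+m\Big)^{-m}d\theta\,d\beta\,d\gamma,$$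 and, for $M>4$, $$p_4(\mathsf{SNR})=\frac{2^n m^m}{\pi\sqrt\pi\,\Gamma(m)}\int_{\frac\pi M-\frac\pi{2^n}}^{\frac\pi M+\frac\pi{2^n}}\int_0^\infty\int_{-\sqrt{\mathsf{SNR}}\,r\cos\theta}^\infty\mathcal Q\Big(\sqrt{2\mathsf{SNR}}\,r\sec\big(\tfrac{2\pi}M\big)\sin\big(\tfrac{2\pi}M-\theta\big)+\sqrt2\,w\tan\big(\tfrac{2\pi}M\big)\Big)r^{2m-1}e^{-(w^2+mr^2)}\,dw\,dr\,d\theta,$$ while $p_4(\mathsf{SNR})=0$ for $M=4$ (there $\sec\frac{2\pi}M$ and $\tan\frac{2\pi}M$ are infinite, the argument of $\mathcal Q$ is $+\infty$ on the domain of integration, and $\mathcal Q(+\infty)=0$). -/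

import Mathlib

open MeasureTheory ProbabilityTheory Set
open scoped Real ENNReal

noncomputable section

namespace PSKLink

/-- The `M`-PSK signal points `exp (j π ((2k+1)/M - 1))`, `k = 0, …, M-1`. -/
def pskConstellation (M : ℕ) : Set ℂ :=
  {x | ∃ k : ℕ, k < M ∧
    x = Complex.exp (Complex.I * ((π * ((2 * (k : ℝ) + 1) / (M : ℝ) - 1) : ℝ) : ℂ))}

/-- The principal argument with values in `[-π, π)`
(Mathlib's `Complex.arg` takes values in `(-π, π]`). -/
def principalArg (z : ℂ) : ℝ :=
  if Complex.arg z = π then -π else Complex.arg z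

theorem neg_pi_le_principalArg (z : ℂ) : -π ≤ principalArg z := by
  unfold principalArg
  split_ifs
  · exact le_rfl
  · exact (Complex.neg_pi_lt_arg z).le

theorem principalArg_lt_pi (z : ℂ) : principalArg z < π := by
  unfold principalArg
  split_ifs with h
  · linarith [Real.pi_pos]
  · exact lt_of_le_of_ne (Complex.arg_le_pi z) h

/-- The `k`-th quantization region `{z : (2π/2^n) k ≤ Arg z + π < (2π/2^n) (k+1)}`. -/
def quantRegion (n k : ℕ) : Set ℂ :=
  {z | 2 * π / 2 ^ n * (k : ℝ) ≤ principalArg z + π ∧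
    principalArg z + π < 2 * π / 2 ^ n * ((k : ℝ) + 1)}

/-- The `n`-bit phase quantizer: the index of the region that contains `z`
(see `quantizer_eq_iff`). -/
def quantizer (n : ℕ) (z : ℂ) : Fin (2 ^ n) :=
  ⟨⌊(principalArg z + π) / (2 * π / 2 ^ n)⌋₊, by
    have h0 : 0 ≤ principalArg z + π := by linarith [neg_pi_le_principalArg z]
    have hc : (0 : ℝ) < 2 * π / 2 ^ n := by positivity
    rw [Nat.floor_lt (by positivity), div_lt_iff₀ hc]
    have h1 : ((2 ^ n : ℕ) : ℝ) * (2 * π / 2 ^ n) = 2 * π := by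
      push_cast
      field_simp
    rw [h1]
    linarith [principalArg_lt_pi z]⟩

theorem quantizer_eq_iff (n : ℕ) (z : ℂ) (k : Fin (2 ^ n)) :
    quantizer n z = k ↔ z ∈ quantRegion n k := by
  have h0 : 0 ≤ principalArg z + π := by linarith [neg_pi_le_principalArg z]
  have hc : (0 : ℝ) < 2 * π / 2 ^ n := by positivity
  rw [Fin.ext_iff]
  simp only [quantizer, quantRegion, Set.mem_ofPred_eq]
  rw [Nat.floor_eq_iff (by positivity), le_div_iff₀ hc, div_lt_iff₀ hc,
    mul_comm (2 * π / 2 ^ n), mul_comm (2 * π / 2 ^ n)]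

/-- The received signal `Y = √SNR H X + W`. -/
def received {Ω : Type*} (snr : ℝ) (X H W : Ω → ℂ) (ω : Ω) : ℂ :=
  (Real.sqrt snr : ℂ) * H ω * X ω + W ω

/-- The pair `(Q(Y), H)` that is available to the detector. -/
def observation {Ω : Type*} (n : ℕ) (snr : ℝ) (X H W : Ω → ℂ) (ω : Ω) : Fin (2 ^ n) × ℂ :=
  (quantizer n (received snr X H W ω), H ω)

/-- The circularly-symmetric complex Gaussian law `CN(0,1)`,
with density `exp (-|w|²) / π` on `ℂ`. -/
def stdComplexGaussian : Measure ℂ :=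
  volume.withDensity fun w => ENNReal.ofReal (1 / π * Real.exp (-‖w‖ ^ 2))

/-- The law of `Z` is invariant under all rotations of the plane. -/
def IsCircularlySymmetric {Ω : Type*} [MeasurableSpace Ω] (μ : Measure Ω) (Z : Ω → ℂ) : Prop :=
  ∀ t : ℝ, μ.map (fun ω => Complex.exp (Complex.I * (t : ℂ)) * Z ω) = μ.map Z

/-- The Nakagami density with shape parameter `m` and spread parameter `s`. -/
def nakagamiPDF (m s r : ℝ) : ℝ :=
  if 0 ≤ r then
    2 * m ^ m / (Real.Gamma m * s ^ m) * r ^ (2 * m - 1) * Real.exp (-(m / s) * r ^ 2)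
  else 0

/-- The Nakagami law with shape parameter `m` and spread parameter `s`. -/
def nakagamiMeasure (m s : ℝ) : Measure ℝ :=
  volume.withDensity fun r => ENNReal.ofReal (nakagamiPDF m s r)

/-- `xhat` is an optimum (maximum a posteriori) detector: a measurable rule with values in the
constellation such that `xhat k h` maximizes `x ↦ P(X = x | Q(Y) = k, H = h)` for almost all
values `(k, h)` of `(Q(Y), H)`; the posterior is the regular conditional distribution of `X`
given `(Q(Y), H)`, which is determined up to null sets only. -/
structure IsOptimumDetector {Ω : Type*} [MeasurableSpace Ω] (μ : Measure Ω) [IsFiniteMeasure μ]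
    (M n : ℕ) (snr : ℝ) (X H W : Ω → ℂ) (xhat : Fin (2 ^ n) → ℂ → ℂ) : Prop where
  measurable : ∀ k, Measurable (xhat k)
  mem : ∀ k h, xhat k h ∈ pskConstellation M
  isMax : ∀ᵐ q ∂(μ.map (observation n snr X H W)),
    IsMaxOn (fun x => condDistrib X (observation n snr X H W) μ q {x})
      (pskConstellation M) (xhat q.1 q.2)

/-- The average symbol error probability `P(X ≠ xhat(Q(Y), H))`. -/
def sep {Ω : Type*} [MeasurableSpace Ω] (μ : Measure Ω) (n : ℕ) (snr : ℝ) (X H W : Ω → ℂ)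
    (xhat : Fin (2 ^ n) → ℂ → ℂ) : ℝ :=
  μ.real {ω | X ω ≠ xhat (quantizer n (received snr X H W ω)) (H ω)}

/-- The complementary distribution function of the standard normal law. -/
def gaussianQ (x : ℝ) : ℝ := (gaussianReal 0 1).real (Ioi x)

def p1 (M n : ℕ) (m snr : ℝ) : ℝ :=
  2 ^ ((n : ℝ) - 1) * m ^ m / π ^ 2 *
    ∫ β in (0 : ℝ)..(π / 2), ∫ θ in (π / M - π / 2 ^ n)..(π / M + π / 2 ^ n),
      (snr / Real.sin β ^ 2 * Real.cos θ ^ 2 + m) ^ (-m)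

def p2 (M n : ℕ) (m snr : ℝ) : ℝ :=
  2 ^ ((n : ℝ) - 1) * m ^ m / π ^ 2 *
    ∫ β in (0 : ℝ)..(π / 2), ∫ θ in (π / M - π / 2 ^ n)..(π / M + π / 2 ^ n),
      (snr / Real.sin β ^ 2 * Real.sin θ ^ 2 + m) ^ (-m)

def p3 (M n : ℕ) (m snr : ℝ) : ℝ :=
  2 ^ ((n : ℝ) - 1) * m ^ m / π ^ 3 *
    ∫ γ in (0 : ℝ)..(π / 2), ∫ β in (0 : ℝ)..(π / 2),
      ∫ θ in (π / M - π / 2 ^ n)..(π / M + π / 2 ^ n),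
        (snr * Real.cos θ ^ 2 / Real.sin β ^ 2 + snr * Real.sin θ ^ 2 / Real.sin γ ^ 2 + m) ^ (-m)

/-- For `M = 4` the secant and the tangent of `2π/M` are infinite: the argument of the
`Q`-function is `+∞` on the whole domain of integration, so the integrand vanishes. -/
def p4 (M n : ℕ) (m snr : ℝ) : ℝ :=
  if M = 4 then 0 else
    2 ^ n * m ^ m / (π * Real.sqrt π * Real.Gamma m) *
      ∫ θ in (π / M - π / 2 ^ n)..(π / M + π / 2 ^ n), ∫ r in Ioi (0 : ℝ),
        ∫ w in Ioi (-(Real.sqrt snr * r * Real.cos θ)),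
          gaussianQ (Real.sqrt (2 * snr) * r * (1 / Real.cos (2 * π / M))
              * Real.sin (2 * π / M - θ) + Real.sqrt 2 * w * Real.tan (2 * π / M))
            * r ^ (2 * m - 1) * Real.exp (-(w ^ 2 + m * r ^ 2))

end PSKLink

end

/-! The received phase is averaged twice: over the phase of the fading coefficient, which is uniform
by circular symmetry, and over the quantization region. Given the magnitude `r` of the fading
coefficient put `ρ = √SNR r` and let `W` be the noise.

**Reduction to a sector.** As the signal points are equally likely, an optimum detector is correct
with probability the mean of the largest likelihood (`measure_eq_optimum`; the optimality of the
posterior is used only through `measure_eq_rule_le_optimum`, by comparison with a measurable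
maximum-likelihood rule). The likelihood of a signal point depends only on the angle between the
noiseless received point and the centre of the quantization region, and it decreases with this
angle (`window_antitoneOn`), because the phase density of `ρ + W` is an increasing function of the
cosine of the phase. Averaged over the uniform phase of the fading coefficient, the largest of the
`M` likelihoods becomes the likelihood of one point averaged over its decision interval
`[-π/M, π/M]` (`integral_iSup_shift`). Exchanging the roles of the decision interval and the quantization window (`integral_window_eq`),
the probability of a correct decision is the mean, over `r` and over `θ` within `π/2^n` of `π/M`,
of the probability that `ρ e^{iθ} + W` lies in the sector of the arguments `(0, 2π/M)`
(`two_pi_mul_measure_eq_optimum`, `sep_eq_integral`).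

**The sector in Cartesian coordinates.** The real and imaginary parts of `W` are independent real
Gaussian variables. For `M = 2` the sector is a half-plane and the error is one Gaussian tail; for
`M = 4` it is a quadrant, with error `Q₁ + Q₂ - Q₁ Q₂`; for `M > 4` it is the quadrant minus a
wedge, whose mass is a single integral of a Gaussian tail (`one_sub_sector_acute`).

**The mean over the magnitude.** The angles `θ` lie in `[0, 2π/M]` because `2^n ≥ M`, so that the
arguments of the tails are nonnegative and Craig's formula (`gaussianQ_sqrt_two_mul`) writes them
as integrals of `exp (-c r²)`, whose Nakagami mean is `m^m (c + m)^(-m)`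
(`integral_exp_nakagamiMeasure`). The four terms of the formula are the means of `Q₁`, `Q₂`, `Q₁ Q₂`
and the wedge. -/

noncomputable section

namespace PSKLink

/-! ### The phase density of a shifted Gaussian variable -/

/-- The density at phase offset `φ`, as a function of `c = cos φ`, of the argument of `ρ + W`
with `W` standard complex Gaussian and `ρ ≥ 0`. -/
def phaseDensity (ρ c : ℝ) : ℝ :=
  ∫ t in Ioi (0 : ℝ), t * (1 / π * Real.exp (-(t ^ 2 - 2 * t * ρ * c + ρ ^ 2)))

theorem integrable_phaseDensity_integrand (ρ c : ℝ) :
    Integrable fun t : ℝ => t * (1 / π * Real.exp (-(t ^ 2 - 2 * t * ρ * c + ρ ^ 2))) := by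
  have h := ((integrable_mul_exp_neg_mul_sq (b := 1 / 2) (by norm_num)).norm).const_mul
    (1 / π * Real.exp (2 * ρ ^ 2 * c ^ 2))
  refine h.mono' (by fun_prop) (Filter.Eventually.of_forall fun t => ?_)
  -- complete the square in half of the quadratic term
  have h1 : Real.exp (-(t ^ 2 - 2 * t * ρ * c + ρ ^ 2))
      ≤ Real.exp (2 * ρ ^ 2 * c ^ 2) * Real.exp (-(1 / 2) * t ^ 2) := by
    rw [← Real.exp_add]
    apply Real.exp_le_exp.2
    nlinarith [sq_nonneg (t - 2 * ρ * c), sq_nonneg ρ]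
  have hp := Real.pi_pos
  simp only [norm_mul, Real.norm_eq_abs, Real.abs_exp, abs_of_pos (one_div_pos.2 hp)]
  calc |t| * (1 / π * Real.exp (-(t ^ 2 - 2 * t * ρ * c + ρ ^ 2)))
      ≤ |t| * (1 / π * (Real.exp (2 * ρ ^ 2 * c ^ 2) * Real.exp (-(1 / 2) * t ^ 2))) := by gcongr
    _ = _ := by ring

theorem phaseDensity_nonneg (ρ c : ℝ) : 0 ≤ phaseDensity ρ c :=
  setIntegral_nonneg measurableSet_Ioi fun t ht => by
    have := Real.pi_pos
    have : 0 < t := ht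
    positivity

theorem phaseDensity_mono {ρ : ℝ} (hρ : 0 ≤ ρ) : Monotone (phaseDensity ρ) := by
  intro c d hcd
  refine setIntegral_mono_on (integrable_phaseDensity_integrand ρ c).integrableOn
    (integrable_phaseDensity_integrand ρ d).integrableOn measurableSet_Ioi fun t ht => ?_
  have ht : 0 < t := ht
  have := Real.pi_pos
  have : 2 * t * ρ * c ≤ 2 * t * ρ * d := by gcongr
  gcongr

theorem measurable_phaseDensity {ρ : ℝ} (hρ : 0 ≤ ρ) : Measurable (phaseDensity ρ) :=
  (phaseDensity_mono hρ).measurable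

theorem intervalIntegrable_phaseDensity_cos {ρ : ℝ} (hρ : 0 ≤ ρ) {f : ℝ → ℝ} (hf : Measurable f)
    (a b : ℝ) : IntervalIntegrable (fun φ => phaseDensity ρ (Real.cos (f φ))) volume a b := by
  refine (intervalIntegrable_const (c := phaseDensity ρ 1)).mono_fun'
    ((measurable_phaseDensity hρ).comp (Real.measurable_cos.comp hf)).aestronglyMeasurable
    (Filter.Eventually.of_forall fun φ => ?_)
  simp only [Real.norm_eq_abs, abs_of_nonneg (phaseDensity_nonneg _ _)]
  exact phaseDensity_mono hρ (Real.cos_le_one _)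

/-- Integration against the law of `z + W` in polar coordinates. -/
theorem stdComplexGaussian_preimage_add_eq_lintegral_polar (z : ℂ) {D : Set ℂ}
    (hD : MeasurableSet D) :
    stdComplexGaussian {w | z + w ∈ D} =
      ∫⁻ φ in Ioo (-π) π, ∫⁻ t in Ioi (0 : ℝ), ENNReal.ofReal t *
        D.indicator (fun y => ENNReal.ofReal (1 / π * Real.exp (-‖y - z‖ ^ 2)))
          (t * (Real.cos φ + Real.sin φ * Complex.I)) := by
  have hm : MeasurableSet {w : ℂ | z + w ∈ D} := measurable_const_add z hD
  have hmeas : Measurable (D.indicator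
      (fun y => ENNReal.ofReal (1 / π * Real.exp (-‖y - z‖ ^ 2)))) :=
    Measurable.indicator (by fun_prop) hD
  rw [stdComplexGaussian, withDensity_apply _ hm, ← lintegral_indicator hm]
  have h1 : ∀ w : ℂ, ({w | z + w ∈ D}.indicator
        (fun w => ENNReal.ofReal (1 / π * Real.exp (-‖w‖ ^ 2))) w) =
      D.indicator (fun y => ENNReal.ofReal (1 / π * Real.exp (-‖y - z‖ ^ 2))) (z + w) := by
    intro w
    by_cases hw : z + w ∈ D
    · rw [indicator_of_mem hw, indicator_of_mem (by exact hw)]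
      simp
    · rw [indicator_of_notMem hw, indicator_of_notMem (by exact hw)]
  simp_rw [h1]
  rw [lintegral_add_left_eq_self (fun y => D.indicator
      (fun y => ENNReal.ofReal (1 / π * Real.exp (-‖y - z‖ ^ 2))) y) z,
    ← Complex.lintegral_comp_polarCoord_symm, polarCoord_target, Measure.volume_eq_prod,
    ← Measure.prod_restrict, lintegral_prod_symm]
  · simp [Complex.polarCoord_symm_apply, smul_eq_mul]
  · refine Measurable.aemeasurable ?_
    simp only [Complex.polarCoord_symm_apply, smul_eq_mul]
    exact (by fun_prop : Measurable fun p : ℝ × ℝ => ENNReal.ofReal p.1).mul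
      (hmeas.comp (by fun_prop))

theorem norm_sq_polar_sub (t φ ρ ψ : ℝ) :
    ‖(t : ℂ) * (Real.cos φ + Real.sin φ * Complex.I) - ρ * Complex.exp (Complex.I * ψ)‖ ^ 2
      = t ^ 2 - 2 * t * ρ * Real.cos (φ - ψ) + ρ ^ 2 := by
  rw [mul_comm Complex.I, Complex.exp_mul_I, ← Complex.normSq_eq_norm_sq, Complex.normSq_apply,
    Real.cos_sub]
  simp only [Complex.ofReal_cos, Complex.ofReal_sin]
  simp
  simp only [Complex.cos_ofReal_re, Complex.sin_ofReal_re]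
  linear_combination t ^ 2 * Real.sin_sq_add_cos_sq φ + ρ ^ 2 * Real.sin_sq_add_cos_sq ψ

/-- Mass of a cone `D` (the points whose argument lies in `A`) under the law of `ρ e^{iψ} + W`. -/
theorem stdComplexGaussian_cone {ρ : ℝ} (ψ : ℝ) {D : Set ℂ} {A : Set ℝ}
    (hD : MeasurableSet D) (hA : MeasurableSet A)
    (h : ∀ t : ℝ, 0 < t → ∀ φ ∈ Ioo (-π) π,
      ((t : ℂ) * (Real.cos φ + Real.sin φ * Complex.I) ∈ D ↔ φ ∈ A)) :
    stdComplexGaussian {w | (ρ : ℂ) * Complex.exp (Complex.I * ψ) + w ∈ D} =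
      ∫⁻ φ in Ioo (-π) π ∩ A, ENNReal.ofReal (phaseDensity ρ (Real.cos (φ - ψ))) := by
  rw [stdComplexGaussian_preimage_add_eq_lintegral_polar _ hD, inter_comm,
    ← Measure.restrict_restrict hA, ← lintegral_indicator hA]
  refine setLIntegral_congr_fun measurableSet_Ioo fun φ hφ => ?_
  by_cases hφA : φ ∈ A
  · rw [indicator_of_mem hφA, phaseDensity, ofReal_integral_eq_lintegral_ofReal
      (integrable_phaseDensity_integrand _ _).integrableOn]
    · refine setLIntegral_congr_fun measurableSet_Ioi fun t ht => ?_
      rw [indicator_of_mem ((h t ht φ hφ).2 hφA), norm_sq_polar_sub,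
        ENNReal.ofReal_mul (le_of_lt ht)]
    · refine (ae_restrict_iff' measurableSet_Ioi).2 (Filter.Eventually.of_forall fun t ht => ?_)
      have : 0 < t := ht
      have := Real.pi_pos
      simp only [Pi.zero_apply]
      positivity
  · rw [indicator_of_notMem hφA, ← lintegral_zero (μ := volume.restrict (Ioi (0 : ℝ)))]
    refine setLIntegral_congr_fun measurableSet_Ioi fun t ht => ?_
    rw [indicator_of_notMem (fun hh => hφA ((h t ht φ hφ).1 hh)), mul_zero]

/-- `stdComplexGaussian_cone` for an interval of arguments, with a real integral. Which end points
belong to the interval is immaterial. -/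
theorem stdComplexGaussian_cone_interval {ρ : ℝ} (hρ : 0 ≤ ρ) (ψ : ℝ) {D : Set ℂ} {A : Set ℝ}
    {a b : ℝ} (hab : a ≤ b) (ha : -π ≤ a) (hb : b ≤ π)
    (hD : MeasurableSet D) (hA : MeasurableSet A)
    (h : ∀ t : ℝ, 0 < t → ∀ φ ∈ Ioo (-π) π,
      ((t : ℂ) * (Real.cos φ + Real.sin φ * Complex.I) ∈ D ↔ φ ∈ A))
    (hA1 : Ioo a b ⊆ A) (hA2 : A ⊆ Icc a b) :
    stdComplexGaussian {w | (ρ : ℂ) * Complex.exp (Complex.I * ψ) + w ∈ D} =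
      ENNReal.ofReal (∫ φ in a..b, phaseDensity ρ (Real.cos (φ - ψ))) := by
  rw [stdComplexGaussian_cone ψ hD hA h, intervalIntegral.integral_of_le hab,
    ofReal_integral_eq_lintegral_ofReal
      (((intervalIntegrable_phaseDensity_cos hρ (by fun_prop) a b)).1)
      (Filter.Eventually.of_forall fun φ => phaseDensity_nonneg _ _)]
  refine setLIntegral_congr ?_
  have h1 : Ioo a b ⊆ Ioo (-π) π ∩ A := fun x hx =>
    ⟨⟨by linarith [hx.1], by linarith [hx.2]⟩, hA1 hx⟩
  have h2 : Ioo (-π) π ∩ A ⊆ Icc a b := fun x hx => hA2 hx.2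
  have e1 : (Ioo a b : Set ℝ) =ᵐ[volume] Icc a b := Ioo_ae_eq_Icc
  have e2 : (Ioc a b : Set ℝ) =ᵐ[volume] Icc a b := Ioc_ae_eq_Icc
  refine Filter.EventuallyEq.trans ?_ e2.symm
  exact Filter.EventuallyLE.antisymm (Filter.Eventually.of_forall h2)
    (e1.symm.le.trans (Filter.Eventually.of_forall h1))

/-! ### Phase windows and the mean of their maximum -/

/-- The probability that the phase of `ρ + W` lies within `δ` of `α`, with `W` standard complex
Gaussian. -/
def window (δ ρ α : ℝ) : ℝ := ∫ φ in (-δ)..δ, phaseDensity ρ (Real.cos (φ + α))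

theorem window_nonneg {δ : ℝ} (hδ : 0 ≤ δ) (ρ α : ℝ) : 0 ≤ window δ ρ α :=
  intervalIntegral.integral_nonneg (by linarith) fun _ _ => phaseDensity_nonneg _ _

theorem window_neg (δ ρ α : ℝ) : window δ ρ (-α) = window δ ρ α := by
  have h := intervalIntegral.integral_comp_neg (a := -δ) (b := δ)
    (fun φ => phaseDensity ρ (Real.cos (φ + α)))
  rw [neg_neg] at h
  rw [window, window, ← h]
  congr 1
  ext φ
  rw [← Real.cos_neg, neg_add, neg_neg]

theorem window_add_int_mul_two_pi (δ ρ α : ℝ) (k : ℤ) :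
    window δ ρ (α + k * (2 * π)) = window δ ρ α := by
  simp only [window, ← add_assoc, Real.cos_add_int_mul_two_pi]

/-- The window probability decreases as the window moves away from the signal phase: a window
moved by `du` loses mass at `u - δ` and gains mass at `u + δ`, where the cosine is smaller. -/
theorem window_antitoneOn {δ ρ : ℝ} (hδ : 0 ≤ δ) (hδπ : δ ≤ π) (hρ : 0 ≤ ρ) :
    AntitoneOn (window δ ρ) (Icc 0 π) := by
  intro α hα β hβ hαβ
  have hI : ∀ a b, IntervalIntegrable (fun φ => phaseDensity ρ (Real.cos φ)) volume a b :=
    fun a b => intervalIntegrable_phaseDensity_cos hρ measurable_id a b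
  have hw : ∀ α, window δ ρ α = ∫ φ in (α - δ)..(α + δ), phaseDensity ρ (Real.cos φ) := by
    intro α
    rw [window, intervalIntegral.integral_comp_add_right (fun φ => phaseDensity ρ (Real.cos φ))]
    congr 1 <;> ring
  rw [← sub_nonneg, hw, hw, intervalIntegral.integral_interval_sub_interval_comm (hI _ _)
    (hI _ _) (hI _ _),
    ← intervalIntegral.integral_comp_sub_right (fun φ => phaseDensity ρ (Real.cos φ)),
    ← intervalIntegral.integral_comp_add_right (fun φ => phaseDensity ρ (Real.cos φ)), sub_nonneg]
  refine intervalIntegral.integral_mono_on hαβ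
    (intervalIntegrable_phaseDensity_cos hρ (by fun_prop) _ _)
    (intervalIntegrable_phaseDensity_cos hρ (by fun_prop) _ _) fun u hu => ?_
  refine phaseDensity_mono hρ ?_
  rw [Real.cos_add, Real.cos_sub]
  have h1 := Real.sin_nonneg_of_nonneg_of_le_pi (hα.1.trans hu.1) (hu.2.trans hβ.2)
  have h2 := Real.sin_nonneg_of_nonneg_of_le_pi hδ hδπ
  nlinarith [mul_nonneg h1 h2]

theorem window_arccos_cos (δ ρ α : ℝ) :
    window δ ρ (Real.arccos (Real.cos α)) = window δ ρ α := by
  have h : Real.cos (Real.arccos (Real.cos α)) = Real.cos α :=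
    Real.cos_arccos (Real.neg_one_le_cos _) (Real.cos_le_one _)
  obtain ⟨k, hk | hk⟩ := Real.cos_eq_cos_iff.1 h
  · conv_rhs => rw [hk, show 2 * (k : ℝ) * π + Real.arccos (Real.cos α)
      = Real.arccos (Real.cos α) + k * (2 * π) by ring, window_add_int_mul_two_pi]
  · conv_rhs => rw [hk, show 2 * (k : ℝ) * π - Real.arccos (Real.cos α)
      = -Real.arccos (Real.cos α) + k * (2 * π) by ring, window_add_int_mul_two_pi, window_neg]

/-- The window probability is an increasing function of the cosine of its centre. -/
theorem window_le_window_of_cos_le {δ ρ : ℝ} (hδ : 0 ≤ δ) (hδπ : δ ≤ π) (hρ : 0 ≤ ρ) {α β : ℝ}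
    (h : Real.cos β ≤ Real.cos α) : window δ ρ β ≤ window δ ρ α := by
  rw [← window_arccos_cos δ ρ α, ← window_arccos_cos δ ρ β]
  exact window_antitoneOn hδ hδπ hρ ⟨Real.arccos_nonneg _, Real.arccos_le_pi _⟩
    ⟨Real.arccos_nonneg _, Real.arccos_le_pi _⟩ (Real.arccos_le_arccos h)

/-- A function of `α` that increases with `cos α` is a monotone function of `cos α`. -/
theorem measurable_of_cos_le {F : ℝ → ℝ} (hF : ∀ α β, Real.cos β ≤ Real.cos α → F β ≤ F α) :
    Measurable F := by
  have hFarc : ∀ α, F α = F (Real.arccos (Real.cos α)) := fun α => by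
    have h : Real.cos (Real.arccos (Real.cos α)) = Real.cos α :=
      Real.cos_arccos (Real.neg_one_le_cos _) (Real.cos_le_one _)
    exact le_antisymm (hF _ _ h.ge) (hF _ _ h.le)
  have hmono : Monotone fun x => F (Real.arccos x) := by
    intro x y hxy
    apply hF
    rcases le_total x (-1) with hx | hx
    · rw [Real.arccos_of_le_neg_one hx, Real.cos_pi]; exact Real.neg_one_le_cos _
    rcases le_total 1 y with hy | hy
    · rw [Real.arccos_of_one_le hy, Real.cos_zero]; exact Real.cos_le_one _
    rw [Real.cos_arccos hx (hxy.trans hy), Real.cos_arccos (hx.trans hxy) hy]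
    exact hxy
  rw [show F = (fun x => F (Real.arccos x)) ∘ Real.cos from funext hFarc]
  exact hmono.measurable.comp Real.measurable_cos

theorem intervalIntegrable_iSup_of_cos_le {F : ℝ → ℝ}
    (hF : ∀ α β, Real.cos β ≤ Real.cos α → F β ≤ F α) {M : ℕ} (hM : 0 < M)
    {f : Fin M → ℝ → ℝ} (hf : ∀ j, Measurable (f j)) (a b : ℝ) :
    IntervalIntegrable (fun t => ⨆ j, F (f j t)) volume a b := by
  have : Nonempty (Fin M) := ⟨⟨0, hM⟩⟩
  have hPm : Measurable fun t => ⨆ j, F (f j t) :=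
    Measurable.iSup fun j => (measurable_of_cos_le hF).comp (hf j)
  refine (intervalIntegrable_const (c := max |F π| |F 0|)).mono_fun'
    hPm.aestronglyMeasurable (Filter.Eventually.of_forall fun t => ?_)
  have hup : ∀ α, F α ≤ F 0 := fun α => hF _ _ (by rw [Real.cos_zero]; exact Real.cos_le_one _)
  have hlo : ∀ α, F π ≤ F α := fun α => hF _ _ (by rw [Real.cos_pi]; exact Real.neg_one_le_cos _)
  have hl : F π ≤ ⨆ j, F (f j t) := (hlo _).trans
    (le_ciSup (f := fun j => F (f j t)) (Set.finite_range _).bddAbove (⟨0, hM⟩ : Fin M))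
  exact abs_le_max_abs_abs hl (ciSup_le fun j => hup _)

/-- If `F α` is a monotone function of `cos α`, then the mean over a full turn of the maximum of
`F` over the `M` shifts by multiples of `2π/M` is the mean of `F` over the decision interval
`[-π/M, π/M]`, on which the unshifted term is the largest. -/
theorem integral_iSup_shift {F : ℝ → ℝ} (hF : ∀ α β, Real.cos β ≤ Real.cos α → F β ≤ F α)
    {M : ℕ} (hM : 0 < M) (c : ℝ) :
    ∫ t in (0 : ℝ)..(2 * π), ⨆ j : Fin M, F (c - t - 2 * π * (j : ℝ) / M) =
      M * ∫ t in (-(π / M))..(π / M), F t := by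
  have hM' : (0 : ℝ) < M := by exact_mod_cast hM
  have : Nonempty (Fin M) := ⟨⟨0, hM⟩⟩
  have hp := Real.pi_pos
  set P : ℝ → ℝ := fun t => ⨆ j : Fin M, F (t - 2 * π * (j : ℝ) / M) with hP
  -- `F` has period `2π`, so every integer shift is one of the `M` shifts
  have hle : ∀ (t : ℝ) (i : ℤ), F (t - 2 * π * (i : ℝ) / M) ≤ P t := by
    intro t i
    have hMz : (M : ℤ) ≠ 0 := by exact_mod_cast hM.ne'
    have h0 := Int.emod_nonneg i hMz
    have h1 := Int.emod_lt_of_pos i (by exact_mod_cast hM : (0 : ℤ) < M)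
    obtain ⟨r, hr⟩ := Int.eq_ofNat_of_zero_le h0
    have hrM : r < M := by omega
    refine le_trans (hF _ _ (le_of_eq ?_))
      (le_ciSup (f := fun j : Fin M => F (t - 2 * π * (j : ℝ) / M))
        (Set.finite_range _).bddAbove (⟨r, hrM⟩ : Fin M))
    have h2 : (i : ℝ) = r + M * (i / M : ℤ) := by
      have := Int.emod_add_mul_ediv i M
      rw [hr] at this
      exact_mod_cast this.symm
    rw [show t - 2 * π * (i : ℝ) / M = t - 2 * π * (r : ℝ) / M - (i / M : ℤ) * (2 * π) by
      rw [h2]; field_simp; ring, Real.cos_sub_int_mul_two_pi]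
  have hper1 : ∀ t, P (t + 2 * π / M) ≤ P t := fun t => ciSup_le fun j => by
    refine le_of_eq_of_le ?_ (hle t ((j : ℤ) - 1))
    congr 1; push_cast; field_simp; ring
  have hper2 : ∀ t, P t ≤ P (t + 2 * π / M) := fun t => ciSup_le fun j => by
    refine le_of_eq_of_le ?_ (hle (t + 2 * π / M) ((j : ℤ) + 1))
    congr 1; push_cast; field_simp; ring
  have hper : Function.Periodic P (2 * π / M) := fun t => le_antisymm (hper1 t) (hper2 t)
  have h1 : ∫ t in (0 : ℝ)..(2 * π), ⨆ j : Fin M, F (c - t - 2 * π * (j : ℝ) / M) =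
      ∫ t in (c - 2 * π)..((c - 2 * π) + (M : ℤ) • (2 * π / M)), P t := by
    have := intervalIntegral.integral_comp_sub_left (a := 0) (b := 2 * π) P c
    rw [show (c - 2 * π) + (M : ℤ) • (2 * π / M) = c - 0 by
      simp; field_simp; ring]
    exact this
  have hInt : ∀ t₁ t₂, IntervalIntegrable P volume t₁ t₂ := fun t₁ t₂ =>
    intervalIntegrable_iSup_of_cos_le hF hM (fun j => by fun_prop) t₁ t₂
  rw [h1, hper.intervalIntegral_add_zsmul_eq _ _ hInt, hper.intervalIntegral_add_eq _ (-(π / M)),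
    show -(π / M) + 2 * π / M = π / M by ring, zsmul_eq_mul]
  push_cast
  congr 1
  refine intervalIntegral.integral_congr fun t ht => ?_
  have hpM : 0 < π / M := by positivity
  rw [uIcc_of_le (by linarith)] at ht
  refine le_antisymm (ciSup_le fun j => hF _ _ ?_) (by simpa using hle t 0)
  -- `cos t - cos (t - 2πj/M) = 2 sin (πj/M - t) sin (πj/M)`, and both sines are nonnegative
  rcases Nat.eq_zero_or_pos (j : ℕ) with h0 | h0
  · simp [h0]
  have hj1 : (1 : ℝ) ≤ (j : ℕ) := by exact_mod_cast h0
  have hjM : ((j : ℕ) : ℝ) + 1 ≤ M := by exact_mod_cast j.2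
  have e1 : π / M * (j : ℕ) + π / M ≤ π := by
    calc π / M * (j : ℕ) + π / M = π / M * ((j : ℕ) + 1) := by ring
      _ ≤ π / M * M := by gcongr
      _ = π := by field_simp
  have e2 : π / M ≤ π / M * (j : ℕ) := le_mul_of_one_le_right hpM.le hj1
  have s1 := Real.sin_nonneg_of_nonneg_of_le_pi (x := π / M * (j : ℕ)) (by linarith) (by linarith)
  have s2 := Real.sin_nonneg_of_nonneg_of_le_pi (x := π / M * (j : ℕ) - t)
    (by linarith [ht.2]) (by linarith [ht.1])
  have hid := Real.cos_sub_cos t (t - 2 * π * (j : ℕ) / M)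
  rw [show (t + (t - 2 * π * (j : ℕ) / M)) / 2 = -(π / M * (j : ℕ) - t) by ring,
    show (t - (t - 2 * π * (j : ℕ) / M)) / 2 = π / M * (j : ℕ) by ring, Real.sin_neg] at hid
  nlinarith [mul_nonneg s1 s2]

/-- Fubini for a bounded measurable function on an interval and a finite measure space. -/
theorem intervalIntegral_integral_swap_of_bounded {α : Type*} [MeasurableSpace α]
    {ν : Measure α} [IsFiniteMeasure ν] {f : ℝ → α → ℝ} (hf : Measurable (Function.uncurry f))
    {C : ℝ} (hC : ∀ x y, |f x y| ≤ C) (a b : ℝ) :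
    ∫ x in a..b, ∫ y, f x y ∂ν = ∫ y, (∫ x in a..b, f x y) ∂ν := by
  have : IsFiniteMeasure (volume.restrict (uIoc a b)) := ⟨by simp [uIoc]⟩
  exact intervalIntegral_integral_swap (Integrable.of_bound hf.aestronglyMeasurable C
    (Filter.Eventually.of_forall fun p => hC p.1 p.2))

theorem intervalIntegral_swap_of_bounded {f : ℝ → ℝ → ℝ} (hf : Measurable (Function.uncurry f))
    {C : ℝ} (hC : ∀ x y, |f x y| ≤ C) (a b : ℝ) {c d : ℝ} (hcd : c ≤ d) :
    ∫ x in a..b, ∫ y in c..d, f x y = ∫ y in c..d, ∫ x in a..b, f x y := by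
  simp only [intervalIntegral.integral_of_le hcd]
  exact intervalIntegral_integral_swap_of_bounded hf hC a b

/-- Averaging the quantization window over the decision interval is the same as averaging the
decision sector over the quantization window. -/
theorem integral_window_eq {δ ρ : ℝ} (hδ : 0 ≤ δ) (hρ : 0 ≤ ρ) (p : ℝ) :
    ∫ t in (-p)..p, window δ ρ t =
      ∫ θ in (p - δ)..(p + δ), ∫ u in (0 : ℝ)..(2 * p), phaseDensity ρ (Real.cos (u - θ)) := by
  have hsub := intervalIntegral.integral_comp_sub_left (a := -δ) (b := δ)
    (fun θ => ∫ u in (0 : ℝ)..(2 * p), phaseDensity ρ (Real.cos (u - θ))) p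
  rw [sub_neg_eq_add] at hsub
  rw [← hsub]
  unfold window
  rw [intervalIntegral_swap_of_bounded (C := phaseDensity ρ 1) _ _ _ _ (by linarith)]
  · congr 1
    ext φ
    have h := intervalIntegral.integral_comp_add_right (a := -p) (b := p)
      (fun u => phaseDensity ρ (Real.cos (u - (p - φ)))) p
    rw [neg_add_cancel, ← two_mul] at h
    rw [← h]
    congr 1
    ext t
    ring_nf
  · exact (measurable_phaseDensity hρ).comp (Real.measurable_cos.comp (by fun_prop))
  · intro x y
    rw [abs_of_nonneg (phaseDensity_nonneg _ _)]
    exact phaseDensity_mono hρ (Real.cos_le_one _)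

/-! ### Cartesian coordinates, Craig's formula and sectors -/

/-- The law of the real and of the imaginary part of a standard complex Gaussian variable. -/
def halfGaussian : Measure ℝ := gaussianReal 0 (1 / 2)

instance : IsProbabilityMeasure halfGaussian := by unfold halfGaussian; infer_instance

instance : NullSingletonClass halfGaussian := by
  unfold halfGaussian; exact nullSingletonClass_gaussianReal (by norm_num)

theorem halfGaussian_eq_withDensity :
    halfGaussian = volume.withDensity fun x =>
      ENNReal.ofReal ((Real.sqrt π)⁻¹ * Real.exp (-x ^ 2)) := by
  rw [halfGaussian, gaussianReal_of_var_ne_zero _ (by norm_num)]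
  congr 1
  ext x
  rw [gaussianPDF, gaussianPDFReal]
  congr 3
  · push_cast
    ring_nf
  · push_cast
    ring_nf

theorem stdComplexGaussian_apply {D : Set ℂ} (hD : MeasurableSet D) :
    stdComplexGaussian D = (halfGaussian.prod halfGaussian)
      {p | Complex.measurableEquivRealProd.symm p ∈ D} := by
  have hD' : MeasurableSet {p | Complex.measurableEquivRealProd.symm p ∈ D} :=
    Complex.measurableEquivRealProd.symm.measurable hD
  rw [stdComplexGaussian, withDensity_apply _ hD, halfGaussian_eq_withDensity,
    prod_withDensity (by fun_prop) (by fun_prop), withDensity_apply _ hD', ← lintegral_indicator hD,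
    ← lintegral_indicator hD', ← (Complex.volume_preserving_equiv_real_prod.symm).lintegral_comp_emb
    Complex.measurableEquivRealProd.symm.measurableEmbedding, Measure.volume_eq_prod]
  refine lintegral_congr fun p => ?_
  have hp := Real.pi_pos
  by_cases h : Complex.measurableEquivRealProd.symm p ∈ D
  · rw [indicator_of_mem h, indicator_of_mem (by exact h), ← ENNReal.ofReal_mul (by positivity)]
    congr 1
    rw [← Complex.normSq_eq_norm_sq, Complex.normSq_apply]
    simp only [Complex.measurableEquivRealProd_symm_apply]
    rw [show -(p.1 * p.1 + p.2 * p.2) = -p.1 ^ 2 + -p.2 ^ 2 by ring, Real.exp_add]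
    have := Real.mul_self_sqrt hp.le
    have h0 : Real.sqrt π ≠ 0 := by positivity
    field_simp
    rw [Real.sq_sqrt hp.le]
  · rw [indicator_of_notMem h, indicator_of_notMem (by exact h)]

instance : IsProbabilityMeasure stdComplexGaussian :=
  ⟨by rw [stdComplexGaussian_apply MeasurableSet.univ]; simp⟩

theorem halfGaussian_real_Ioi (x : ℝ) :
    halfGaussian.real (Ioi x) = gaussianQ (Real.sqrt 2 * x) := by
  have h2 : 0 < Real.sqrt 2 := by positivity
  have h : gaussianReal 0 1 = halfGaussian.map (fun y => Real.sqrt 2 * y) := by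
    rw [halfGaussian, gaussianReal_map_const_mul]
    congr 1
    · simp
    · ext; simp
  rw [gaussianQ, h, map_measureReal_apply (by fun_prop) measurableSet_Ioi]
  congr 1
  ext y
  simp [h2]

theorem halfGaussian_real_Ici (x : ℝ) :
    halfGaussian.real (Ici x) = gaussianQ (Real.sqrt 2 * x) := by
  rw [← halfGaussian_real_Ioi]
  exact measureReal_congr Ioi_ae_eq_Ici.symm

theorem halfGaussian_real_Ioi_neg (x : ℝ) :
    halfGaussian.real (Ioi (-x)) = 1 - gaussianQ (Real.sqrt 2 * x) := by
  have h : halfGaussian = halfGaussian.map (fun y => -y) := by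
    rw [halfGaussian, gaussianReal_map_neg, neg_zero]
  rw [← halfGaussian_real_Ici, ← probReal_compl_eq_one_sub measurableSet_Ici, h,
    map_measureReal_apply (by fun_prop) measurableSet_Ioi, ← h, compl_Ici]
  congr 1
  ext y
  simp

theorem lintegral_Ioi_radial (a : ℝ) (ha : 0 ≤ a) :
    ∫⁻ t in Ioi a, ENNReal.ofReal (t * (1 / π * Real.exp (-t ^ 2))) =
      ENNReal.ofReal (1 / (2 * π) * Real.exp (-a ^ 2)) := by
  have hp := Real.pi_pos
  have hint : Integrable fun t : ℝ => t * (1 / π * Real.exp (-t ^ 2)) := by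
    simpa using integrable_phaseDensity_integrand 0 0
  rw [← ofReal_integral_eq_lintegral_ofReal hint.integrableOn]
  · congr 1
    have hd : ∀ t ∈ Ici a, HasDerivAt (fun t : ℝ => -(1 / (2 * π)) * Real.exp (-t ^ 2))
        (t * (1 / π * Real.exp (-t ^ 2))) t := by
      intro t _
      have h1 : HasDerivAt (fun t : ℝ => -t ^ 2) (-(2 * t)) t := by
        simpa using (hasDerivAt_pow 2 t).fun_neg
      refine (h1.exp.const_mul (-(1 / (2 * π)))).congr_deriv ?_
      field_simp
    have hlim : Filter.Tendsto (fun t : ℝ => -(1 / (2 * π)) * Real.exp (-t ^ 2)) Filter.atTop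
        (nhds (-(1 / (2 * π)) * 0)) := by
      refine Filter.Tendsto.const_mul _ (Real.tendsto_exp_neg_atTop_nhds_zero.comp ?_)
      exact Filter.tendsto_pow_atTop (by norm_num)
    rw [integral_Ioi_of_hasDerivAt_of_tendsto' hd hint.integrableOn hlim]
    ring
  · refine (ae_restrict_iff' measurableSet_Ioi).2 (Filter.Eventually.of_forall fun t ht => ?_)
    have : 0 < t := lt_of_le_of_lt ha ht
    simp only [Pi.zero_apply]
    positivity

/-- **Craig's formula** for the Gaussian tail, obtained by computing the mass of the half-plane
`{Re w > x}` in polar coordinates. -/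
theorem gaussianQ_sqrt_two_mul {x : ℝ} (hx : 0 ≤ x) :
    gaussianQ (Real.sqrt 2 * x) =
      1 / π * ∫ β in (0 : ℝ)..(π / 2), Real.exp (-(x ^ 2 / Real.sin β ^ 2)) := by
  have hp := Real.pi_pos
  have hD : MeasurableSet {y : ℂ | x < y.re} := measurableSet_lt measurable_const (by fun_prop)
  have hprod : stdComplexGaussian.real {y : ℂ | x < y.re} = gaussianQ (Real.sqrt 2 * x) := by
    rw [← halfGaussian_real_Ioi, Measure.real, stdComplexGaussian_apply hD]
    have : {p : ℝ × ℝ | Complex.measurableEquivRealProd.symm p ∈ {y : ℂ | x < y.re}} =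
        Ioi x ×ˢ univ := by
      ext p; simp [Complex.measurableEquivRealProd_symm_apply]
    rw [this, Measure.prod_prod, measure_univ, mul_one, Measure.real]
  rw [← hprod]
  have hpol := stdComplexGaussian_preimage_add_eq_lintegral_polar 0 hD
  simp only [zero_add, ofPred_mem_eq, sub_zero] at hpol
  -- the radial integral over `{t cos φ > x}`
  have hin : ∀ φ ∈ Ioo (-π) π, ∫⁻ t in Ioi (0 : ℝ), ENNReal.ofReal t *
        {y : ℂ | x < y.re}.indicator (fun y => ENNReal.ofReal (1 / π * Real.exp (-‖y‖ ^ 2)))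
          (t * (Real.cos φ + Real.sin φ * Complex.I)) =
      (Ioo (-(π / 2)) (π / 2)).indicator (fun φ => ENNReal.ofReal
        (1 / (2 * π) * Real.exp (-(x ^ 2 / Real.cos φ ^ 2)))) φ := by
    intro φ hφ
    have hre : ∀ t : ℝ, ((t : ℂ) * (Real.cos φ + Real.sin φ * Complex.I)).re = t * Real.cos φ := by
      intro t
      simp [-Complex.ofReal_cos, -Complex.ofReal_sin]
    by_cases hφ2 : φ ∈ Ioo (-(π / 2)) (π / 2)
    · have hc := Real.cos_pos_of_mem_Ioo hφ2
      rw [indicator_of_mem hφ2, ← div_pow, ← lintegral_Ioi_radial _ (by positivity),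
        show Ioi (x / Real.cos φ) = Ioi (x / Real.cos φ) ∩ Ioi 0 by
          rw [Ioi_inter_Ioi, sup_of_le_left (by positivity)],
        ← Measure.restrict_restrict measurableSet_Ioi,
        ← lintegral_indicator (s := Ioi (x / Real.cos φ)) measurableSet_Ioi]
      refine setLIntegral_congr_fun measurableSet_Ioi fun t ht => ?_
      have ht : 0 < t := ht
      by_cases h : x / Real.cos φ < t
      · have h' : (t : ℂ) * (Real.cos φ + Real.sin φ * Complex.I) ∈ {y : ℂ | x < y.re} := by
          rw [mem_ofPred_eq, hre]; exact (div_lt_iff₀ hc).1 h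
        rw [indicator_of_mem h', indicator_of_mem (by exact h), ← ENNReal.ofReal_mul ht.le]
        have := norm_sq_polar_sub t φ 0 0
        simp only [Complex.ofReal_zero, zero_mul, sub_zero, mul_zero] at this
        rw [this]
        simp
      · have h' : (t : ℂ) * (Real.cos φ + Real.sin φ * Complex.I) ∉ {y : ℂ | x < y.re} := by
          rw [mem_ofPred_eq, hre]; exact fun h' => h ((div_lt_iff₀ hc).2 h')
        rw [indicator_of_notMem h', indicator_of_notMem (by exact h), mul_zero]
    · have hc : Real.cos φ ≤ 0 := by
        rw [← Real.cos_abs]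
        have h1 : π / 2 ≤ |φ| := not_lt.1 fun h => hφ2 (abs_lt.1 h)
        have h2 : |φ| ≤ π := (abs_lt.2 hφ).le
        exact Real.cos_nonpos_of_pi_div_two_le_of_le h1 (by linarith)
      rw [indicator_of_notMem hφ2, ← lintegral_zero (μ := volume.restrict (Ioi (0 : ℝ)))]
      refine setLIntegral_congr_fun measurableSet_Ioi fun t ht => ?_
      have ht : 0 < t := ht
      rw [indicator_of_notMem (by
        rw [mem_ofPred_eq, hre]; nlinarith), mul_zero]
  -- at a zero of `f` the quotient is `0`, which keeps the bound and the measurability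
  have hmeas : ∀ f : ℝ → ℝ, Measurable f → ∀ a b, IntervalIntegrable
      (fun β => Real.exp (-(x ^ 2 / f β ^ 2))) volume a b := by
    intro f hf a b
    refine (intervalIntegrable_const (c := 1)).mono_fun'
      (Measurable.aestronglyMeasurable (by fun_prop))
      (Filter.Eventually.of_forall fun φ => ?_)
    simp only [Real.norm_eq_abs, Real.abs_exp, Real.exp_le_one_iff]
    have : 0 ≤ x ^ 2 / f φ ^ 2 := by positivity
    linarith
  have hsub : Ioo (-(π / 2)) (π / 2) ⊆ Ioo (-π) π := Ioo_subset_Ioo (by linarith) (by linarith)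
  rw [Measure.real, hpol, setLIntegral_congr_fun measurableSet_Ioo hin,
    lintegral_indicator measurableSet_Ioo, Measure.restrict_restrict measurableSet_Ioo,
    inter_eq_self_of_subset_left hsub, restrict_Ioo_eq_restrict_Ioc,
    ← ofReal_integral_eq_lintegral_ofReal, ← intervalIntegral.integral_of_le (by linarith),
    ENNReal.toReal_ofReal, intervalIntegral.integral_const_mul]
  -- `φ = π/2 - β` turns the cosine into a sine, symmetric about `β = π/2`
  · have e1 := intervalIntegral.integral_comp_sub_left (a := 0) (b := π)
      (fun φ => Real.exp (-(x ^ 2 / Real.cos φ ^ 2))) (π / 2)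
    have e2 := intervalIntegral.integral_comp_sub_left (a := π / 2) (b := π)
      (fun φ => Real.exp (-(x ^ 2 / Real.sin φ ^ 2))) π
    simp only [Real.cos_pi_div_two_sub, Real.sin_pi_sub, sub_self, sub_zero] at e1 e2
    rw [show π / 2 - π = -(π / 2) by ring] at e1
    rw [show π - π / 2 = π / 2 by ring] at e2
    rw [← e1, ← intervalIntegral.integral_add_adjacent_intervals
      (hmeas _ Real.measurable_sin 0 (π / 2)) (hmeas _ Real.measurable_sin (π / 2) π), e2]
    field_simp
    ring
  · exact intervalIntegral.integral_nonneg (by linarith) fun φ _ => by positivity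
  · exact ((hmeas _ Real.measurable_cos _ _).const_mul _).1
  · exact Filter.Eventually.of_forall fun φ => by simp only [Pi.zero_apply]; positivity

/-- The open sector of the points with argument in `(0, α)`, for `0 < α ≤ π`, as the intersection
of the upper half-plane with the half-plane to the right of the ray of argument `α`. -/
def sector (α : ℝ) : Set ℂ := {y | 0 < y.im ∧ y.im * Real.cos α < y.re * Real.sin α}

theorem measurableSet_sector (α : ℝ) : MeasurableSet (sector α) :=
  MeasurableSet.inter (s₁ := {y : ℂ | 0 < y.im})
    (s₂ := {y : ℂ | y.im * Real.cos α < y.re * Real.sin α})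
    (measurableSet_lt measurable_const (by fun_prop)) (measurableSet_lt (by fun_prop) (by fun_prop))

theorem polar_mem_sector_iff {α t φ : ℝ} (hα0 : 0 < α) (hα : α ≤ π) (ht : 0 < t)
    (hφ : φ ∈ Ioo (-π) π) :
    (t : ℂ) * (Real.cos φ + Real.sin φ * Complex.I) ∈ sector α ↔ φ ∈ Ioo 0 α := by
  have hre : ((t : ℂ) * (Real.cos φ + Real.sin φ * Complex.I)).re = t * Real.cos φ := by
    simp [-Complex.ofReal_cos, -Complex.ofReal_sin]
  have him : ((t : ℂ) * (Real.cos φ + Real.sin φ * Complex.I)).im = t * Real.sin φ := by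
    simp [-Complex.ofReal_cos, -Complex.ofReal_sin]
  rw [sector, mem_ofPred_eq, hre, him, mul_assoc, mul_assoc, mul_lt_mul_iff_right₀ ht,
    mul_pos_iff_of_pos_left ht]
  have hs := Real.sin_sub α φ
  constructor
  · rintro ⟨h1, h2⟩
    have h0 : 0 < φ := by
      by_contra h
      exact absurd h1 (not_lt.2 (Real.sin_nonpos_of_nonpos_of_neg_pi_le (not_lt.1 h) hφ.1.le))
    refine ⟨h0, ?_⟩
    by_contra h
    have := Real.sin_nonpos_of_nonpos_of_neg_pi_le (x := α - φ) (by linarith)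
      (by linarith [hφ.2])
    linarith
  · rintro ⟨h1, h2⟩
    have := Real.sin_pos_of_pos_of_lt_pi (x := α - φ) (by linarith) (by linarith)
    exact ⟨Real.sin_pos_of_pos_of_lt_pi h1 hφ.2, by linarith⟩

theorem stdComplexGaussian_sector {ρ α : ℝ} (hρ : 0 ≤ ρ) (hα0 : 0 < α) (hα : α ≤ π) (θ : ℝ) :
    ∫ u in (0 : ℝ)..α, phaseDensity ρ (Real.cos (u - θ)) =
      stdComplexGaussian.real {w | (ρ : ℂ) * Complex.exp (Complex.I * θ) + w ∈ sector α} := by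
  have hp := Real.pi_pos
  rw [Measure.real, stdComplexGaussian_cone_interval hρ θ hα0.le (by linarith) hα
    (measurableSet_sector α) measurableSet_Ioo (fun t ht φ hφ => polar_mem_sector_iff hα0 hα ht hφ)
    subset_rfl Ioo_subset_Icc_self, ENNReal.toReal_ofReal]
  exact intervalIntegral.integral_nonneg hα0.le fun _ _ => phaseDensity_nonneg _ _

/-! ### Sector probabilities and Nakagami moments -/

theorem measurable_gaussianQ : Measurable gaussianQ := by
  have : Antitone gaussianQ := fun x y hxy => measureReal_mono (Ioi_subset_Ioi hxy)
  exact this.measurable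

theorem gaussianQ_nonneg (x : ℝ) : 0 ≤ gaussianQ x := measureReal_nonneg

theorem gaussianQ_le_one (x : ℝ) : gaussianQ x ≤ 1 := measureReal_le_one

theorem integral_halfGaussian (f : ℝ → ℝ) (s : Set ℝ) (hs : MeasurableSet s) :
    ∫ w in s, f w ∂halfGaussian = ∫ w in s, f w * ((Real.sqrt π)⁻¹ * Real.exp (-w ^ 2)) := by
  rw [halfGaussian_eq_withDensity, setIntegral_withDensity_eq_setIntegral_toReal_smul (by fun_prop)
    (Filter.Eventually.of_forall fun _ => ENNReal.ofReal_lt_top) _ hs]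
  refine setIntegral_congr_fun hs fun w _ => ?_
  have := Real.pi_pos
  simp only [smul_eq_mul]
  rw [ENNReal.toReal_ofReal (by positivity), mul_comm]

/-- The mass, under the law of `a + b i + W`, of the part of the open first quadrant on or above
the line through `0` with slope `τ > 0`. -/
def wedge (τ a b : ℝ) : ℝ :=
  ∫ w in Ioi (-a), gaussianQ (Real.sqrt 2 * (τ * (a + w) - b)) *
    ((Real.sqrt π)⁻¹ * Real.exp (-w ^ 2))

/-- The set is the wedge for `τ > 0`: its two conditions force a positive imaginary part. -/
theorem measureReal_wedge (τ a b : ℝ) :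
    (halfGaussian.prod halfGaussian).real {p | -a < p.1 ∧ τ * (a + p.1) - b ≤ p.2} =
      wedge τ a b := by
  have hm : MeasurableSet {p : ℝ × ℝ | -a < p.1 ∧ τ * (a + p.1) - b ≤ p.2} :=
    MeasurableSet.inter (s₁ := {p : ℝ × ℝ | -a < p.1}) (s₂ := {p | τ * (a + p.1) - b ≤ p.2})
      (measurableSet_lt (by fun_prop) (by fun_prop)) (measurableSet_le (by fun_prop) (by fun_prop))
  have hsec : ∀ w : ℝ, halfGaussian (Prod.mk w ⁻¹' {p | -a < p.1 ∧ τ * (a + p.1) - b ≤ p.2}) =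
      (Ioi (-a)).indicator (fun w => halfGaussian (Ici (τ * (a + w) - b))) w := by
    intro w
    by_cases hw : -a < w
    · rw [indicator_of_mem (by exact hw)]
      congr 1
      ext v
      simp [hw]
    · rw [indicator_of_notMem (by exact hw)]
      simp [hw]
  have hmeas : Measurable fun w => halfGaussian.real (Ici (τ * (a + w) - b)) := by
    simp_rw [halfGaussian_real_Ici]
    exact measurable_gaussianQ.comp (by fun_prop)
  have hmeas' : Measurable fun w => halfGaussian (Ici (τ * (a + w) - b)) := by
    simpa [Measure.real, ENNReal.ofReal_toReal] using hmeas.ennreal_ofReal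
  rw [Measure.real, Measure.prod_apply hm]
  simp_rw [hsec]
  rw [lintegral_indicator measurableSet_Ioi, ← integral_toReal hmeas'.aemeasurable
    (Filter.Eventually.of_forall fun _ => measure_lt_top _ _)]
  change ∫ w in Ioi (-a), halfGaussian.real (Ici (τ * (a + w) - b)) ∂halfGaussian = _
  simp_rw [halfGaussian_real_Ici]
  exact integral_halfGaussian _ _ measurableSet_Ioi

theorem stdComplexGaussian_shift_sector (ρ θ α : ℝ) :
    stdComplexGaussian.real {w | (ρ : ℂ) * Complex.exp (Complex.I * θ) + w ∈ sector α} =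
      (halfGaussian.prod halfGaussian).real {p | 0 < ρ * Real.sin θ + p.2 ∧
        (ρ * Real.sin θ + p.2) * Real.cos α < (ρ * Real.cos θ + p.1) * Real.sin α} := by
  have hm : MeasurableSet {w | (ρ : ℂ) * Complex.exp (Complex.I * θ) + w ∈ sector α} :=
    measurable_const_add _ (measurableSet_sector α)
  rw [Measure.real, stdComplexGaussian_apply hm, Measure.real]
  congr 2
  ext p
  have hre : ((ρ : ℂ) * Complex.exp (Complex.I * θ)).re = ρ * Real.cos θ := by
    rw [mul_comm Complex.I]; simp [Complex.exp_ofReal_mul_I_re]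
  have him : ((ρ : ℂ) * Complex.exp (Complex.I * θ)).im = ρ * Real.sin θ := by
    rw [mul_comm Complex.I]; simp [Complex.exp_ofReal_mul_I_im]
  simp only [sector, mem_ofPred_eq, Complex.add_im, Complex.add_re, hre, him,
    Complex.measurableEquivRealProd_symm_apply]

/-- The sector of opening `π` is the upper half-plane. -/
theorem one_sub_sector_pi (ρ θ : ℝ) :
    1 - stdComplexGaussian.real {w | (ρ : ℂ) * Complex.exp (Complex.I * θ) + w ∈ sector π} =
      gaussianQ (Real.sqrt 2 * (ρ * Real.sin θ)) := by
  have : {p : ℝ × ℝ | 0 < ρ * Real.sin θ + p.2 ∧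
        (ρ * Real.sin θ + p.2) * Real.cos π < (ρ * Real.cos θ + p.1) * Real.sin π} =
      univ ×ˢ Ioi (-(ρ * Real.sin θ)) := by
    ext p
    simp only [Real.cos_pi, Real.sin_pi, mem_ofPred_eq, mem_prod, mem_univ, true_and, mem_Ioi]
    constructor
    · rintro ⟨h, _⟩; linarith
    · intro h; constructor <;> linarith
  rw [stdComplexGaussian_shift_sector, this, measureReal_prod_prod, probReal_univ,
    halfGaussian_real_Ioi_neg]
  ring

/-- The sector of opening `π/2` is the first quadrant. -/
theorem one_sub_sector_pi_div_two (ρ θ : ℝ) :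
    1 - stdComplexGaussian.real {w | (ρ : ℂ) * Complex.exp (Complex.I * θ) + w ∈ sector (π / 2)} =
      gaussianQ (Real.sqrt 2 * (ρ * Real.cos θ)) + gaussianQ (Real.sqrt 2 * (ρ * Real.sin θ)) -
        gaussianQ (Real.sqrt 2 * (ρ * Real.cos θ)) *
          gaussianQ (Real.sqrt 2 * (ρ * Real.sin θ)) := by
  have : {p : ℝ × ℝ | 0 < ρ * Real.sin θ + p.2 ∧ (ρ * Real.sin θ + p.2) * Real.cos (π / 2)
        < (ρ * Real.cos θ + p.1) * Real.sin (π / 2)} =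
      Ioi (-(ρ * Real.cos θ)) ×ˢ Ioi (-(ρ * Real.sin θ)) := by
    ext p
    simp only [Real.cos_pi_div_two, Real.sin_pi_div_two, mem_ofPred_eq, mem_prod, mem_Ioi]
    constructor <;> rintro ⟨h, h'⟩ <;> constructor <;> linarith
  rw [stdComplexGaussian_shift_sector, this, measureReal_prod_prod,
    halfGaussian_real_Ioi_neg, halfGaussian_real_Ioi_neg]
  ring

/-- An acute sector is the quadrant minus a wedge. -/
theorem one_sub_sector_acute {α : ℝ} (hα0 : 0 < α) (hα : α < π / 2) (ρ θ : ℝ) :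
    1 - stdComplexGaussian.real {w | (ρ : ℂ) * Complex.exp (Complex.I * θ) + w ∈ sector α} =
      gaussianQ (Real.sqrt 2 * (ρ * Real.cos θ)) + gaussianQ (Real.sqrt 2 * (ρ * Real.sin θ)) -
        gaussianQ (Real.sqrt 2 * (ρ * Real.cos θ)) * gaussianQ (Real.sqrt 2 * (ρ * Real.sin θ)) +
        wedge (Real.tan α) (ρ * Real.cos θ) (ρ * Real.sin θ) := by
  have hs := Real.sin_pos_of_pos_of_lt_pi hα0 (by linarith [Real.pi_pos])
  have hc := Real.cos_pos_of_mem_Ioo (x := α) ⟨by linarith, hα⟩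
  have ht : 0 < Real.tan α := Real.tan_pos_of_pos_of_lt_pi_div_two hα0 hα
  rw [← one_sub_sector_pi_div_two, ← measureReal_wedge, stdComplexGaussian_shift_sector,
    stdComplexGaussian_shift_sector]
  generalize ρ * Real.cos θ = a
  generalize ρ * Real.sin θ = b
  have hm : MeasurableSet {p : ℝ × ℝ | -a < p.1 ∧ Real.tan α * (a + p.1) - b ≤ p.2} :=
    MeasurableSet.inter (s₁ := {p : ℝ × ℝ | -a < p.1})
      (s₂ := {p | Real.tan α * (a + p.1) - b ≤ p.2})
      (measurableSet_lt (by fun_prop) (by fun_prop)) (measurableSet_le (by fun_prop) (by fun_prop))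
  have hiff : ∀ p : ℝ × ℝ, (b + p.2) * Real.cos α < (a + p.1) * Real.sin α ↔
      p.2 < Real.tan α * (a + p.1) - b := by
    intro p
    rw [Real.tan_eq_sin_div_cos, lt_sub_iff_add_lt, div_mul_eq_mul_div, lt_div_iff₀ hc,
      mul_comm (Real.sin α), add_comm p.2]
  have hun : {p : ℝ × ℝ | 0 < b + p.2 ∧ (b + p.2) * Real.cos (π / 2)
        < (a + p.1) * Real.sin (π / 2)} =
      {p | 0 < b + p.2 ∧ (b + p.2) * Real.cos α < (a + p.1) * Real.sin α} ∪
      {p | -a < p.1 ∧ Real.tan α * (a + p.1) - b ≤ p.2} := by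
    ext p
    simp only [mem_union, mem_ofPred_eq, hiff, Real.cos_pi_div_two, Real.sin_pi_div_two, mul_zero,
      mul_one]
    constructor
    · rintro ⟨h1, h2⟩
      rcases lt_or_ge p.2 (Real.tan α * (a + p.1) - b) with h | h
      · exact Or.inl ⟨h1, h⟩
      · exact Or.inr ⟨by linarith, h⟩
    · rintro (⟨h1, h2⟩ | ⟨h1, h2⟩)
      · exact ⟨h1, pos_of_mul_pos_right (a := Real.tan α) (by linarith) ht.le⟩
      · have : 0 < Real.tan α * (a + p.1) := mul_pos ht (by linarith)
        exact ⟨by linarith, by linarith⟩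
  rw [hun, measureReal_union _ hm]
  · ring
  · rw [Set.disjoint_left]
    rintro p ⟨_, h⟩ ⟨_, h'⟩
    exact absurd ((hiff p).1 h) (not_lt.2 h')

theorem measurable_nakagamiPDF (m s : ℝ) : Measurable (nakagamiPDF m s) := by
  unfold nakagamiPDF
  exact Measurable.ite measurableSet_Ici (by fun_prop) measurable_const

theorem nakagamiPDF_nonneg {m s : ℝ} (hm : 0 < m) (hs : 0 < s) (r : ℝ) : 0 ≤ nakagamiPDF m s r := by
  unfold nakagamiPDF
  have := Real.Gamma_pos_of_pos hm
  split_ifs <;> positivity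

theorem integral_nakagamiMeasure {m s : ℝ} (hm : 0 < m) (hs : 0 < s) (f : ℝ → ℝ) :
    ∫ r, f r ∂nakagamiMeasure m s = ∫ r in Ioi (0 : ℝ), f r *
      (2 * m ^ m / (Real.Gamma m * s ^ m) * r ^ (2 * m - 1) * Real.exp (-(m / s) * r ^ 2)) := by
  rw [nakagamiMeasure, integral_withDensity_eq_integral_toReal_smul
    (measurable_nakagamiPDF m s).ennreal_ofReal
    (Filter.Eventually.of_forall fun _ => ENNReal.ofReal_lt_top), ← integral_Ici_eq_integral_Ioi,
    ← integral_indicator measurableSet_Ici]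
  congr 1
  ext r
  rw [ENNReal.toReal_ofReal (nakagamiPDF_nonneg hm hs r), smul_eq_mul, nakagamiPDF, mul_comm]
  by_cases hr : 0 ≤ r
  · rw [indicator_of_mem (by exact hr), if_pos hr]
  · rw [indicator_of_notMem (by exact hr), if_neg hr, mul_zero]

theorem integral_rpow_mul_exp_neg_mul_sq {q b : ℝ} (hq : -1 < q) (hb : 0 < b) :
    ∫ r in Ioi (0 : ℝ), r ^ q * Real.exp (-b * r ^ 2) =
      b ^ (-(q + 1) / 2) * (1 / 2) * Real.Gamma ((q + 1) / 2) := by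
  rw [← integral_rpow_mul_exp_neg_mul_rpow (by norm_num) hq hb]
  simp

theorem integral_exp_nakagamiMeasure {m c : ℝ} (hm : 0 < m) (hc : 0 ≤ c) :
    ∫ r, Real.exp (-(c * r ^ 2)) ∂nakagamiMeasure m 1 = m ^ m * (c + m) ^ (-m) := by
  have h := integral_rpow_mul_exp_neg_mul_sq (q := 2 * m - 1) (b := c + m) (by linarith)
    (by linarith)
  have hG := (Real.Gamma_pos_of_pos hm).ne'
  rw [integral_nakagamiMeasure hm one_pos]
  have : ∀ r : ℝ, Real.exp (-(c * r ^ 2)) *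
      (2 * m ^ m / (Real.Gamma m * 1 ^ m) * r ^ (2 * m - 1) * Real.exp (-(m / 1) * r ^ 2)) =
      2 * m ^ m / Real.Gamma m * (r ^ (2 * m - 1) * Real.exp (-(c + m) * r ^ 2)) := by
    intro r
    rw [show -(c + m) * r ^ 2 = -(c * r ^ 2) + -(m / 1) * r ^ 2 by ring, Real.exp_add,
      Real.one_rpow]
    ring
  simp_rw [this]
  rw [integral_const_mul, h, show (2 * m - 1 + 1) / 2 = m by ring,
    show -(2 * m - 1 + 1) / 2 = -m by ring]
  field_simp

/-- The spread parameter of a Nakagami law is its second moment. -/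
theorem integral_sq_nakagamiMeasure {m s : ℝ} (hm : 0 < m) (hs : 0 < s) :
    ∫ r, r ^ 2 ∂nakagamiMeasure m s = s := by
  have h := integral_rpow_mul_exp_neg_mul_sq (q := 2 * m + 1) (b := m / s) (by linarith)
    (by positivity)
  have hG := (Real.Gamma_pos_of_pos hm).ne'
  rw [integral_nakagamiMeasure hm hs]
  have : ∀ r ∈ Ioi (0 : ℝ), r ^ 2 *
      (2 * m ^ m / (Real.Gamma m * s ^ m) * r ^ (2 * m - 1) * Real.exp (-(m / s) * r ^ 2)) =
      2 * m ^ m / (Real.Gamma m * s ^ m) * (r ^ (2 * m + 1) * Real.exp (-(m / s) * r ^ 2)) := by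
    intro r hr
    have hr : 0 < r := hr
    rw [show 2 * m + 1 = 2 + (2 * m - 1) by ring, Real.rpow_add hr, Real.rpow_two]
    ring
  rw [setIntegral_congr_fun measurableSet_Ioi this, integral_const_mul, h,
    show (2 * m + 1 + 1) / 2 = m + 1 by ring, show -(2 * m + 1 + 1) / 2 = -(m + 1) by ring,
    Real.Gamma_add_one hm.ne', Real.rpow_neg (by positivity), Real.div_rpow hm.le hs.le,
    Real.rpow_add_one hm.ne', Real.rpow_add_one hs.ne']
  have := Real.rpow_pos_of_pos hm m
  have := Real.rpow_pos_of_pos hs m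
  field_simp

/-! ### Means over the fading magnitude -/

theorem measurable_intervalIntegral {α : Type*} [MeasurableSpace α] {f : α → ℝ → ℝ}
    (hf : Measurable (Function.uncurry f)) (a b : ℝ) : Measurable fun x => ∫ y in a..b, f x y := by
  unfold intervalIntegral
  exact (hf.stronglyMeasurable.integral_prod_right.measurable).sub
    (hf.stronglyMeasurable.integral_prod_right.measurable)

theorem abs_intervalIntegral_le {f : ℝ → ℝ} {C : ℝ} (h : ∀ x, |f x| ≤ C) (a b : ℝ) :
    |∫ x in a..b, f x| ≤ C * |b - a| :=
  intervalIntegral.norm_integral_le_of_norm_le_const (f := f) fun x _ => h x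

theorem ae_nonneg_nakagamiMeasure (m s : ℝ) : ∀ᵐ r ∂nakagamiMeasure m s, 0 ≤ r := by
  rw [nakagamiMeasure, ae_withDensity_iff (measurable_nakagamiPDF m s).ennreal_ofReal]
  refine Filter.Eventually.of_forall fun r h => ?_
  by_contra hr
  exact h (by simp [nakagamiPDF, hr])

theorem integral_intervalIntegral_add {ν : Measure ℝ} [IsFiniteMeasure ν] {f g : ℝ → ℝ → ℝ}
    (hf : Measurable (Function.uncurry f)) (hg : Measurable (Function.uncurry g))
    {C D : ℝ} (hC : ∀ x y, |f x y| ≤ C) (hD : ∀ x y, |g x y| ≤ D) (a b : ℝ) :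
    ∫ x, (∫ y in a..b, (f x y + g x y)) ∂ν =
      (∫ x, (∫ y in a..b, f x y) ∂ν) + ∫ x, (∫ y in a..b, g x y) ∂ν := by
  have h1 : ∀ (k : ℝ → ℝ → ℝ) (K : ℝ), Measurable (Function.uncurry k) → (∀ x y, |k x y| ≤ K) →
      ∀ x, IntervalIntegrable (k x) volume a b := by
    intro k K hk hK x
    exact (intervalIntegrable_const (c := K)).mono_fun'
      (hk.comp measurable_prodMk_left).aestronglyMeasurable (Filter.Eventually.of_forall (hK x))
  rw [← integral_add]
  · congr 1
    ext x
    exact intervalIntegral.integral_add (h1 f C hf hC x) (h1 g D hg hD x)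
  · exact Integrable.of_bound (measurable_intervalIntegral hf a b).aestronglyMeasurable _
      (Filter.Eventually.of_forall fun x => abs_intervalIntegral_le (hC x) a b)
  · exact Integrable.of_bound (measurable_intervalIntegral hg a b).aestronglyMeasurable _
      (Filter.Eventually.of_forall fun x => abs_intervalIntegral_le (hD x) a b)

theorem rpow_neg_mul_rpow_bound {m x : ℝ} (hm : 0 < m) (hx : 0 ≤ x) :
    |m ^ m * (x + m) ^ (-m)| ≤ 1 := by
  have h1 : (x + m) ^ (-m) ≤ m ^ (-m) :=
    Real.rpow_le_rpow_of_nonpos hm (by linarith) (by linarith)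
  have h2 : m ^ m * m ^ (-m) = 1 := by rw [← Real.rpow_add hm]; simp
  rw [abs_of_nonneg (by positivity), ← h2]
  gcongr

theorem abs_exp_neg_le_one {x : ℝ} (hx : 0 ≤ x) : |Real.exp (-x)| ≤ 1 := by
  rw [Real.abs_exp]; exact Real.exp_le_one_iff.2 (by linarith)

section Averages

variable {m σ : ℝ}

/-- The mean of one Gaussian tail over the fading magnitude and the phase. -/
theorem integral_nakagami_gaussianQ [IsProbabilityMeasure (nakagamiMeasure m 1)] (hm : 0 < m)
    (hσ : 0 ≤ σ) {f : ℝ → ℝ} (hf : Measurable f) {c d : ℝ} (hcd : c ≤ d)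
    (hf0 : ∀ θ ∈ Icc c d, 0 ≤ f θ) :
    ∫ r, (∫ θ in c..d, gaussianQ (Real.sqrt 2 * (σ * r * f θ))) ∂nakagamiMeasure m 1 =
      m ^ m / π * ∫ β in (0 : ℝ)..(π / 2), ∫ θ in c..d,
        (σ ^ 2 / Real.sin β ^ 2 * f θ ^ 2 + m) ^ (-m) := by
  rw [← intervalIntegral_integral_swap_of_bounded
    (f := fun θ r => gaussianQ (Real.sqrt 2 * (σ * r * f θ))) (C := 1)
    (measurable_gaussianQ.comp (by fun_prop))
    (fun θ r => by rw [abs_of_nonneg (gaussianQ_nonneg _)]; exact gaussianQ_le_one _)]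
  have hθ : ∀ θ ∈ uIcc c d, ∫ r, gaussianQ (Real.sqrt 2 * (σ * r * f θ)) ∂nakagamiMeasure m 1 =
      1 / π * ∫ β in (0 : ℝ)..(π / 2),
        m ^ m * (σ ^ 2 / Real.sin β ^ 2 * f θ ^ 2 + m) ^ (-m) := by
    intro θ hθ
    rw [uIcc_of_le hcd] at hθ
    have h0 := hf0 θ hθ
    have hae : ∀ᵐ r ∂nakagamiMeasure m 1, gaussianQ (Real.sqrt 2 * (σ * r * f θ)) =
        1 / π * ∫ β in (0 : ℝ)..(π / 2), Real.exp (-((σ * r * f θ) ^ 2 / Real.sin β ^ 2)) := by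
      filter_upwards [ae_nonneg_nakagamiMeasure m 1] with r hr
      exact gaussianQ_sqrt_two_mul (by positivity)
    rw [integral_congr_ae hae, integral_const_mul, ← intervalIntegral_integral_swap_of_bounded
      (f := fun β r => Real.exp (-((σ * r * f θ) ^ 2 / Real.sin β ^ 2))) (C := 1) (by fun_prop)
      (fun β r => abs_exp_neg_le_one (by positivity))]
    congr 2
    ext β
    rw [← integral_exp_nakagamiMeasure hm (c := σ ^ 2 / Real.sin β ^ 2 * f θ ^ 2) (by positivity)]
    congr 1
    ext r
    ring_nf
  rw [intervalIntegral.integral_congr hθ, intervalIntegral.integral_const_mul,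
    intervalIntegral_swap_of_bounded (C := 1)
      (f := fun θ β => m ^ m * (σ ^ 2 / Real.sin β ^ 2 * f θ ^ 2 + m) ^ (-m)) (by fun_prop)
      (fun θ β => rpow_neg_mul_rpow_bound hm (by positivity)) _ _ (by positivity)]
  simp_rw [intervalIntegral.integral_const_mul]
  ring

/-- The mean of a product of two Gaussian tails over the fading magnitude and the phase. -/
theorem integral_nakagami_gaussianQ_mul [IsProbabilityMeasure (nakagamiMeasure m 1)] (hm : 0 < m)
    (hσ : 0 ≤ σ) {f g : ℝ → ℝ} (hf : Measurable f) (hg : Measurable g) {c d : ℝ} (hcd : c ≤ d)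
    (hf0 : ∀ θ ∈ Icc c d, 0 ≤ f θ) (hg0 : ∀ θ ∈ Icc c d, 0 ≤ g θ) :
    ∫ r, (∫ θ in c..d, gaussianQ (Real.sqrt 2 * (σ * r * f θ)) *
        gaussianQ (Real.sqrt 2 * (σ * r * g θ))) ∂nakagamiMeasure m 1 =
      m ^ m / π ^ 2 * ∫ γ in (0 : ℝ)..(π / 2), ∫ β in (0 : ℝ)..(π / 2), ∫ θ in c..d,
        (σ ^ 2 * f θ ^ 2 / Real.sin β ^ 2 + σ ^ 2 * g θ ^ 2 / Real.sin γ ^ 2 + m) ^ (-m) := by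
  have hp : (0 : ℝ) ≤ π / 2 := by positivity
  rw [← intervalIntegral_integral_swap_of_bounded
    (f := fun θ r => gaussianQ (Real.sqrt 2 * (σ * r * f θ)) *
        gaussianQ (Real.sqrt 2 * (σ * r * g θ))) (C := 1)
    ((measurable_gaussianQ.comp (by fun_prop)).mul (measurable_gaussianQ.comp (by fun_prop)))
    (fun θ r => by
      rw [abs_of_nonneg (mul_nonneg (gaussianQ_nonneg _) (gaussianQ_nonneg _))]
      exact mul_le_one₀ (gaussianQ_le_one _) (gaussianQ_nonneg _) (gaussianQ_le_one _))]
  have hθ : ∀ θ ∈ uIcc c d, ∫ r, gaussianQ (Real.sqrt 2 * (σ * r * f θ)) *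
        gaussianQ (Real.sqrt 2 * (σ * r * g θ)) ∂nakagamiMeasure m 1 =
      1 / π ^ 2 * ∫ γ in (0 : ℝ)..(π / 2), ∫ β in (0 : ℝ)..(π / 2), m ^ m *
        (σ ^ 2 * f θ ^ 2 / Real.sin β ^ 2 + σ ^ 2 * g θ ^ 2 / Real.sin γ ^ 2 + m) ^ (-m) := by
    intro θ hθ
    rw [uIcc_of_le hcd] at hθ
    have h0 := hf0 θ hθ
    have h1 := hg0 θ hθ
    have hae : ∀ᵐ r ∂nakagamiMeasure m 1, gaussianQ (Real.sqrt 2 * (σ * r * f θ)) *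
          gaussianQ (Real.sqrt 2 * (σ * r * g θ)) =
        1 / π ^ 2 * ∫ γ in (0 : ℝ)..(π / 2), ∫ β in (0 : ℝ)..(π / 2),
          Real.exp (-((σ * r * f θ) ^ 2 / Real.sin β ^ 2 +
            (σ * r * g θ) ^ 2 / Real.sin γ ^ 2)) := by
      filter_upwards [ae_nonneg_nakagamiMeasure m 1] with r hr
      rw [gaussianQ_sqrt_two_mul (by positivity), gaussianQ_sqrt_two_mul (by positivity)]
      simp_rw [neg_add, Real.exp_add, intervalIntegral.integral_mul_const,
        intervalIntegral.integral_const_mul]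
      ring
    have hmeas : Measurable (Function.uncurry fun (q : ℝ × ℝ) β =>
        Real.exp (-((σ * q.2 * f θ) ^ 2 / Real.sin β ^ 2 +
            (σ * q.2 * g θ) ^ 2 / Real.sin q.1 ^ 2))) := by
      unfold Function.uncurry
      fun_prop
    rw [integral_congr_ae hae, integral_const_mul, ← intervalIntegral_integral_swap_of_bounded
      (f := fun γ r => ∫ β in (0 : ℝ)..(π / 2), Real.exp (-((σ * r * f θ) ^ 2 / Real.sin β ^ 2 +
            (σ * r * g θ) ^ 2 / Real.sin γ ^ 2)))
      (measurable_intervalIntegral hmeas 0 (π / 2))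
      (fun β r => abs_intervalIntegral_le (fun γ => abs_exp_neg_le_one (by positivity)) _ _)]
    congr 2
    ext γ
    rw [← intervalIntegral_integral_swap_of_bounded
      (f := fun β r => Real.exp (-((σ * r * f θ) ^ 2 / Real.sin β ^ 2 +
            (σ * r * g θ) ^ 2 / Real.sin γ ^ 2))) (C := 1) (by unfold Function.uncurry; fun_prop)
      (fun β r => abs_exp_neg_le_one (by positivity))]
    congr 1
    ext β
    rw [← integral_exp_nakagamiMeasure hm
      (c := σ ^ 2 * f θ ^ 2 / Real.sin β ^ 2 + σ ^ 2 * g θ ^ 2 / Real.sin γ ^ 2) (by positivity)]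
    congr 1
    ext r
    ring_nf
  have hmeas : Measurable (Function.uncurry fun (q : ℝ × ℝ) β => m ^ m *
      (σ ^ 2 * f q.1 ^ 2 / Real.sin β ^ 2 + σ ^ 2 * g q.1 ^ 2 / Real.sin q.2 ^ 2 + m) ^ (-m)) := by
    unfold Function.uncurry
    fun_prop
  rw [intervalIntegral.integral_congr hθ, intervalIntegral.integral_const_mul,
    intervalIntegral_swap_of_bounded
      (f := fun θ γ => ∫ β in (0 : ℝ)..(π / 2), m ^ m *
        (σ ^ 2 * f θ ^ 2 / Real.sin β ^ 2 + σ ^ 2 * g θ ^ 2 / Real.sin γ ^ 2 + m) ^ (-m))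
      (measurable_intervalIntegral hmeas 0 (π / 2))
      (fun θ γ => abs_intervalIntegral_le (fun β => rpow_neg_mul_rpow_bound hm (by positivity)) _ _)
      _ _ hp]
  have hsw : ∀ γ : ℝ, ∫ θ in c..d, ∫ β in (0 : ℝ)..(π / 2), m ^ m *
        (σ ^ 2 * f θ ^ 2 / Real.sin β ^ 2 + σ ^ 2 * g θ ^ 2 / Real.sin γ ^ 2 + m) ^ (-m) =
      m ^ m * ∫ β in (0 : ℝ)..(π / 2), ∫ θ in c..d,
        (σ ^ 2 * f θ ^ 2 / Real.sin β ^ 2 + σ ^ 2 * g θ ^ 2 / Real.sin γ ^ 2 + m) ^ (-m) := by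
    intro γ
    rw [intervalIntegral_swap_of_bounded (C := 1)
      (f := fun θ β => m ^ m *
        (σ ^ 2 * f θ ^ 2 / Real.sin β ^ 2 + σ ^ 2 * g θ ^ 2 / Real.sin γ ^ 2 + m) ^ (-m))
      (by unfold Function.uncurry; fun_prop)
      (fun θ β => rpow_neg_mul_rpow_bound hm (by positivity)) _ _ hp]
    simp_rw [intervalIntegral.integral_const_mul]
  simp_rw [hsw, intervalIntegral.integral_const_mul]
  ring

theorem measurable_wedge (τ : ℝ) : Measurable fun q : ℝ × ℝ => wedge τ q.1 q.2 := by
  simp_rw [← measureReal_wedge]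
  have hm : MeasurableSet {x : (ℝ × ℝ) × (ℝ × ℝ) | -x.1.1 < x.2.1 ∧
      τ * (x.1.1 + x.2.1) - x.1.2 ≤ x.2.2} :=
    MeasurableSet.inter (s₁ := {x : (ℝ × ℝ) × (ℝ × ℝ) | -x.1.1 < x.2.1})
      (s₂ := {x | τ * (x.1.1 + x.2.1) - x.1.2 ≤ x.2.2})
      (measurableSet_lt (by fun_prop) (by fun_prop)) (measurableSet_le (by fun_prop) (by fun_prop))
  exact (measurable_measure_prodMk_left (ν := halfGaussian.prod halfGaussian) hm).ennreal_toReal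

theorem abs_wedge_le_one (τ a b : ℝ) : |wedge τ a b| ≤ 1 := by
  rw [← measureReal_wedge, abs_of_nonneg measureReal_nonneg]
  exact measureReal_le_one

/-- The mean of the wedge probability over the fading magnitude and the phase. -/
theorem integral_nakagami_wedge [IsProbabilityMeasure (nakagamiMeasure m 1)] (hm : 0 < m)
    (σ : ℝ) {α : ℝ} (hα : Real.cos α ≠ 0) (c d : ℝ) :
    ∫ r, (∫ θ in c..d, wedge (Real.tan α) (σ * r * Real.cos θ) (σ * r * Real.sin θ))
        ∂nakagamiMeasure m 1 =
      2 * m ^ m / (Real.sqrt π * Real.Gamma m) *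
      ∫ θ in c..d, ∫ r in Ioi (0 : ℝ), ∫ w in Ioi (-(σ * r * Real.cos θ)),
          gaussianQ (Real.sqrt 2 * σ * r * (1 / Real.cos α)
              * Real.sin (α - θ) + Real.sqrt 2 * w * Real.tan α)
            * r ^ (2 * m - 1) * Real.exp (-(w ^ 2 + m * r ^ 2)) := by
  rw [← intervalIntegral_integral_swap_of_bounded (C := 1)
    (f := fun θ r => wedge (Real.tan α) (σ * r * Real.cos θ) (σ * r * Real.sin θ))
    ((measurable_wedge (Real.tan α)).comp
      (f := fun x : ℝ × ℝ => (σ * x.2 * Real.cos x.1, σ * x.2 * Real.sin x.1)) (by fun_prop))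
    (fun θ r => abs_wedge_le_one _ _ _), ← intervalIntegral.integral_const_mul]
  congr 1
  ext θ
  rw [integral_nakagamiMeasure hm one_pos, ← integral_const_mul]
  congr 1
  ext r
  rw [wedge, ← integral_mul_const, ← integral_const_mul]
  congr 1
  ext w
  have harg : Real.sqrt 2 * (Real.tan α * (σ * r * Real.cos θ + w) - σ * r * Real.sin θ) =
      Real.sqrt 2 * σ * r * (1 / Real.cos α) * Real.sin (α - θ) +
        Real.sqrt 2 * w * Real.tan α := by
    rw [Real.sin_sub, Real.tan_eq_sin_div_cos]
    field_simp
    ring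
  rw [harg, show -(w ^ 2 + m * r ^ 2) = -w ^ 2 + -(m / 1) * r ^ 2 by ring, Real.exp_add,
    Real.one_rpow, mul_one]
  have := Real.Gamma_pos_of_pos hm
  have := Real.sqrt_pos.2 Real.pi_pos
  field_simp

end Averages

/-! ### Optimum detection -/

/-- The signal point with index `j`. -/
def pskPoint (M j : ℕ) : ℂ :=
  Complex.exp (Complex.I * ((π * ((2 * (j : ℝ) + 1) / (M : ℝ) - 1) : ℝ) : ℂ))

theorem pskPoint_mem {M j : ℕ} (h : j < M) : pskPoint M j ∈ pskConstellation M := ⟨j, h, rfl⟩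

theorem coe_image_pskPoint (M : ℕ) :
    ((Finset.range M).image (pskPoint M) : Set ℂ) = pskConstellation M := by
  ext x
  simp [pskConstellation, pskPoint, eq_comm]

theorem measurable_principalArg : Measurable principalArg :=
  Measurable.ite (Complex.measurable_arg (measurableSet_singleton π)) measurable_const
    Complex.measurable_arg

theorem measurableSet_quantRegion (n k : ℕ) : MeasurableSet (quantRegion n k) := by
  have h := measurable_principalArg
  exact MeasurableSet.inter (s₁ := {z | 2 * π / 2 ^ n * (k : ℝ) ≤ principalArg z + π})
    (s₂ := {z | principalArg z + π < 2 * π / 2 ^ n * ((k : ℝ) + 1)})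
    (measurableSet_le (by fun_prop) (by fun_prop)) (measurableSet_lt (by fun_prop) (by fun_prop))

theorem measurable_quantizer (n : ℕ) : Measurable (quantizer n) := by
  refine measurable_to_countable' fun k => ?_
  have : quantizer n ⁻¹' {k} = quantRegion n k := by
    ext z; exact quantizer_eq_iff n z k
  rw [this]
  exact measurableSet_quantRegion n k

/-- The probability that the quantizer outputs `k` when `x` is sent over the channel gain `h`. -/
def likelihood (n : ℕ) (snr : ℝ) (k : Fin (2 ^ n)) (h x : ℂ) : ℝ≥0∞ :=
  stdComplexGaussian {w | (Real.sqrt snr : ℂ) * h * x + w ∈ quantRegion n k}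

theorem measurable_likelihood (n : ℕ) (snr : ℝ) (k : Fin (2 ^ n)) (x : ℂ) :
    Measurable fun h => likelihood n snr k h x := by
  have hm : MeasurableSet {p : ℂ × ℂ | (Real.sqrt snr : ℂ) * p.1 * x + p.2 ∈ quantRegion n k} :=
    (by fun_prop : Measurable fun p : ℂ × ℂ => (Real.sqrt snr : ℂ) * p.1 * x + p.2)
      (measurableSet_quantRegion n k)
  exact measurable_measure_prodMk_left hm

section Detection

variable {Ω : Type*} [MeasurableSpace Ω] {μ : Measure Ω} [IsProbabilityMeasure μ]
  {M n : ℕ} {snr : ℝ} {X H W : Ω → ℂ}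

theorem measurable_received (hX : Measurable X) (hH : Measurable H) (hW : Measurable W) :
    Measurable (received snr X H W) := by
  unfold received; fun_prop

theorem measurable_observation (hX : Measurable X) (hH : Measurable H) (hW : Measurable W) :
    Measurable (observation n snr X H W) :=
  ((measurable_quantizer n).comp (measurable_received hX hH hW)).prodMk hH

/-- The probability that a rule is correct is the mean posterior probability of its decision. -/
theorem measure_eq_rule (hX : Measurable X) (hH : Measurable H) (hW : Measurable W)
    {g : Fin (2 ^ n) → ℂ → ℂ} (hg : ∀ k, Measurable (g k)) :
    μ {ω | X ω = g (quantizer n (received snr X H W ω)) (H ω)} =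
      ∫⁻ q, condDistrib X (observation n snr X H W) μ q {g q.1 q.2}
        ∂(μ.map (observation n snr X H W)) := by
  have hobs := measurable_observation (n := n) (snr := snr) hX hH hW
  have hg' : Measurable fun q : Fin (2 ^ n) × ℂ => g q.1 q.2 :=
    measurable_from_prod_countable_right hg
  have hA : MeasurableSet {p : (Fin (2 ^ n) × ℂ) × ℂ | p.2 = g p.1.1 p.1.2} :=
    measurableSet_eq_fun measurable_snd (hg'.comp measurable_fst)
  have h0 : (μ.map (observation n snr X H W)) ⊗ₘ condDistrib X (observation n snr X H W) μ =
      μ.map fun ω => (observation n snr X H W ω, X ω) := compProd_map_condDistrib hX.aemeasurable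
  have h := congrArg (fun ν => ν {p : (Fin (2 ^ n) × ℂ) × ℂ | p.2 = g p.1.1 p.1.2}) h0
  rw [Measure.compProd_apply hA, Measure.map_apply (hobs.prodMk hX) hA] at h
  exact h.symm

/-- An optimum detector is correct at least as often as any measurable rule. -/
theorem measure_eq_rule_le_optimum (hX : Measurable X) (hH : Measurable H) (hW : Measurable W)
    {xhat : Fin (2 ^ n) → ℂ → ℂ} (hopt : IsOptimumDetector μ M n snr X H W xhat)
    {g : Fin (2 ^ n) → ℂ → ℂ} (hg : ∀ k, Measurable (g k))
    (hgC : ∀ k h, g k h ∈ pskConstellation M) :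
    μ {ω | X ω = g (quantizer n (received snr X H W ω)) (H ω)} ≤
      μ {ω | X ω = xhat (quantizer n (received snr X H W ω)) (H ω)} := by
  rw [measure_eq_rule hX hH hW hg, measure_eq_rule hX hH hW hopt.measurable]
  refine lintegral_mono_ae ?_
  filter_upwards [hopt.isMax] with q hq
  exact hq (hgC q.1 q.2)

/-- The probability that a rule is correct, in terms of the likelihoods. -/
theorem measure_eq_rule_eq_sum (hX : Measurable X) (hH : Measurable H) (hW : Measurable W)
    (hindep : iIndepFun ![X, H, W] μ)
    (hXu : ∀ x ∈ pskConstellation M, μ {ω | X ω = x} = (M : ℝ≥0∞)⁻¹)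
    (hWlaw : μ.map W = stdComplexGaussian)
    {g : Fin (2 ^ n) → ℂ → ℂ} (hg : ∀ k, Measurable (g k))
    (hgC : ∀ k h, g k h ∈ pskConstellation M) :
    μ {ω | X ω = g (quantizer n (received snr X H W ω)) (H ω)} =
      (M : ℝ≥0∞)⁻¹ * ∑ k, ∫⁻ h, likelihood n snr k h (g k h) ∂(μ.map H) := by
  classical
  set C := (Finset.range M).image (pskPoint M) with hC
  have hCmem : ∀ x, x ∈ C ↔ x ∈ pskConstellation M := fun x => by
    rw [← coe_image_pskPoint, Finset.mem_coe]
  have hmeas : ∀ i : Fin 3, Measurable (![X, H, W] i) := by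
    intro i; fin_cases i <;> assumption
  have hHW : IndepFun H W μ := by
    simpa using hindep.indepFun (i := 1) (j := 2) (by decide)
  have hXHW : IndepFun X (fun ω => (H ω, W ω)) μ := by
    simpa using (hindep.indepFun_prodMk hmeas 1 2 0 (by decide) (by decide)).symm
  have hmap : μ.map (fun ω => (H ω, W ω)) = (μ.map H).prod stdComplexGaussian := by
    rw [← hWlaw]
    exact (indepFun_iff_map_prod_eq_prod_map_map hH.aemeasurable hW.aemeasurable).1 hHW
  -- the rule decides correctly for `x` and the output `k`
  let E : Fin (2 ^ n) × ℂ → Set (ℂ × ℂ) := fun kx =>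
    {p | g kx.1 p.1 = kx.2 ∧ (Real.sqrt snr : ℂ) * p.1 * kx.2 + p.2 ∈ quantRegion n kx.1}
  have hE : ∀ kx, MeasurableSet (E kx) := fun kx =>
    MeasurableSet.inter (s₁ := {p : ℂ × ℂ | g kx.1 p.1 = kx.2})
      (s₂ := {p : ℂ × ℂ | (Real.sqrt snr : ℂ) * p.1 * kx.2 + p.2 ∈ quantRegion n kx.1})
      (((hg kx.1).comp measurable_fst) (measurableSet_singleton kx.2))
      ((by fun_prop : Measurable fun p : ℂ × ℂ => (Real.sqrt snr : ℂ) * p.1 * kx.2 + p.2)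
        (measurableSet_quantRegion n kx.1))
  let A : Fin (2 ^ n) × ℂ → Set Ω := fun kx =>
    X ⁻¹' {kx.2} ∩ (fun ω => (H ω, W ω)) ⁻¹' E kx
  have hAm : ∀ kx, MeasurableSet (A kx) := fun kx =>
    (hX (measurableSet_singleton _)).inter ((hH.prodMk hW) (hE kx))
  have hQ : ∀ ω kx, ω ∈ A kx ↔ X ω = kx.2 ∧ g kx.1 (H ω) = kx.2 ∧
      quantizer n (received snr X H W ω) = kx.1 := by
    intro ω kx
    simp only [A, E, mem_inter_iff, mem_preimage, mem_singleton_iff, mem_ofPred_eq,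
      quantizer_eq_iff, received]
    constructor <;> rintro ⟨h0, h1, h2⟩ <;> refine ⟨h0, h1, ?_⟩ <;> simpa only [h0] using h2
  have hset : {ω | X ω = g (quantizer n (received snr X H W ω)) (H ω)} =
      ⋃ kx ∈ (Finset.univ ×ˢ C : Finset (Fin (2 ^ n) × ℂ)), A kx := by
    ext ω
    simp only [mem_ofPred_eq, mem_iUnion, hQ, Finset.mem_product, Finset.mem_univ, true_and,
      exists_prop]
    constructor
    · intro h
      exact ⟨(quantizer n (received snr X H W ω), X ω), (hCmem _).2 (h ▸ hgC _ _), rfl, h.symm, rfl⟩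
    · rintro ⟨⟨k, x⟩, _, h1, h2, h3⟩
      simp only at h1 h2 h3
      rw [h1, h3, h2]
  have hA : ∀ k, ∀ x ∈ C, μ (A (k, x)) = (M : ℝ≥0∞)⁻¹ *
      ∫⁻ h, {h | g k h = x}.indicator (fun h => likelihood n snr k h (g k h)) h ∂(μ.map H) := by
    intro k x hx
    rw [hXHW.measure_inter_preimage_eq_mul _ _ (measurableSet_singleton _) (hE _),
      ← Measure.map_apply (hH.prodMk hW) (hE _), hmap, Measure.prod_apply (hE _)]
    congr 1
    · exact hXu x ((hCmem x).1 hx)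
    · refine lintegral_congr fun h => ?_
      by_cases hgx : g k h = x
      · rw [indicator_of_mem (by exact hgx), likelihood, hgx]
        congr 1
        ext w
        simp [E, hgx]
      · rw [indicator_of_notMem (by exact hgx)]
        simp [E, hgx]
  rw [hset, measure_biUnion_finset _ (fun kx _ => hAm kx), Finset.sum_product, Finset.mul_sum]
  · refine Finset.sum_congr rfl fun k _ => ?_
    have hlik : Measurable fun q : ℂ × ℂ => likelihood n snr k q.1 q.2 := by
      have hm : MeasurableSet {p : (ℂ × ℂ) × ℂ |
          (Real.sqrt snr : ℂ) * p.1.1 * p.1.2 + p.2 ∈ quantRegion n k} :=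
        (by fun_prop : Measurable fun p : (ℂ × ℂ) × ℂ =>
          (Real.sqrt snr : ℂ) * p.1.1 * p.1.2 + p.2) (measurableSet_quantRegion n k)
      exact measurable_measure_prodMk_left hm
    rw [Finset.sum_congr rfl (hA k), ← Finset.mul_sum, ← lintegral_finsetSum]
    · congr 1
      refine lintegral_congr fun h => ?_
      rw [Finset.sum_eq_single_of_mem (g k h) ((hCmem _).2 (hgC k h))]
      · rw [indicator_of_mem (by exact rfl)]
      · intro x _ hx
        rw [indicator_of_notMem (by exact fun h' => hx h'.symm)]
    · intro x _
      exact (hlik.comp (measurable_id.prodMk (hg k))).indicator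
        ((hg k) (measurableSet_singleton x))
  · intro a _ b _ hab
    refine Set.disjoint_left.2 fun ω ha hb => hab ?_
    rw [hQ] at ha hb
    exact Prod.ext (ha.2.2.symm.trans hb.2.2) (ha.1.symm.trans hb.1)

/-- An optimum detector maximizes the likelihood, so that its probability of being correct is the
mean of the largest likelihood. -/
theorem measure_eq_optimum (hM : 0 < M) (hX : Measurable X) (hH : Measurable H) (hW : Measurable W)
    (hindep : iIndepFun ![X, H, W] μ)
    (hXu : ∀ x ∈ pskConstellation M, μ {ω | X ω = x} = (M : ℝ≥0∞)⁻¹)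
    (hWlaw : μ.map W = stdComplexGaussian)
    {xhat : Fin (2 ^ n) → ℂ → ℂ} (hopt : IsOptimumDetector μ M n snr X H W xhat) :
    μ {ω | X ω = xhat (quantizer n (received snr X H W ω)) (H ω)} =
      (M : ℝ≥0∞)⁻¹ * ∑ k, ∫⁻ h, ⨆ j : Fin M, likelihood n snr k h (pskPoint M j) ∂(μ.map H) := by
  classical
  have : Nonempty (Fin M) := ⟨⟨0, hM⟩⟩
  refine le_antisymm ?_ ?_
  · rw [measure_eq_rule_eq_sum hX hH hW hindep hXu hWlaw hopt.measurable hopt.mem]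
    gcongr with k _ h
    obtain ⟨j, hj, hx⟩ := hopt.mem k h
    rw [hx]
    exact le_iSup (fun j : Fin M => likelihood n snr k h (pskPoint M j)) ⟨j, hj⟩
  · have hex : ∀ k h, ∃ j : ℕ, j < M ∧ likelihood n snr k h (pskPoint M j) =
        ⨆ j : Fin M, likelihood n snr k h (pskPoint M j) := by
      intro k h
      obtain ⟨j, hj⟩ := exists_eq_ciSup_of_finite
        (f := fun j : Fin M => likelihood n snr k h (pskPoint M j))
      exact ⟨j, j.2, hj⟩
    -- the first index that maximizes the likelihood depends measurably on `h`
    let g : Fin (2 ^ n) → ℂ → ℂ := fun k h => pskPoint M (Nat.find (hex k h))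
    have hg : ∀ k, Measurable (g k) := by
      intro k
      refine (measurable_from_top (f := pskPoint M)).comp (measurable_find (hex k) fun j => ?_)
      exact MeasurableSet.inter (MeasurableSet.const _)
        (measurableSet_eq_fun (measurable_likelihood n snr k _)
          (Measurable.iSup fun j => measurable_likelihood n snr k _))
    have hgC : ∀ k h, g k h ∈ pskConstellation M := fun k h =>
      pskPoint_mem (Nat.find_spec (hex k h)).1
    refine le_of_eq_of_le ?_ (measure_eq_rule_le_optimum hX hH hW hopt hg hgC)
    rw [measure_eq_rule_eq_sum hX hH hW hindep hXu hWlaw hg hgC]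
    congr 1
    refine Finset.sum_congr rfl fun k _ => lintegral_congr fun h => ?_
    exact (Nat.find_spec (hex k h)).2.symm

/-- A circularly symmetric law may be averaged over rotations. -/
theorem lintegral_map_of_circularlySymmetric (hH : Measurable H)
    (hsymm : IsCircularlySymmetric μ H) {f : ℂ → ℝ≥0∞} (hf : Measurable f) :
    ENNReal.ofReal (2 * π) * ∫⁻ h, f h ∂(μ.map H) =
      ∫⁻ h, (∫⁻ t : ℝ in Ioc 0 (2 * π), f (Complex.exp (Complex.I * (t : ℂ)) * h))
        ∂(μ.map H) := by
  have : IsProbabilityMeasure (μ.map H) := Measure.isProbabilityMeasure_map hH.aemeasurable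
  have hrot : ∀ t : ℝ, ∫⁻ h, f (Complex.exp (Complex.I * (t : ℂ)) * h) ∂(μ.map H) =
      ∫⁻ h, f h ∂(μ.map H) := by
    intro t
    conv_rhs => rw [← hsymm t]
    rw [lintegral_map (f := fun h => f (Complex.exp (Complex.I * (t : ℂ)) * h))
      (hf.comp (by fun_prop)) hH, lintegral_map hf (by fun_prop)]
  rw [lintegral_lintegral_swap]
  · simp_rw [hrot]
    simp [mul_comm]
  · exact (hf.comp (by fun_prop : Measurable fun p : ℂ × ℝ =>
      Complex.exp (Complex.I * (p.2 : ℂ)) * p.1)).aemeasurable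

end Detection

theorem polar_mem_quantRegion_iff (n k : ℕ) {t φ : ℝ} (ht : 0 < t) (hφ : φ ∈ Ioo (-π) π) :
    (t : ℂ) * (Real.cos φ + Real.sin φ * Complex.I) ∈ quantRegion n k ↔
      φ ∈ Ico (2 * π / 2 ^ n * k - π) (2 * π / 2 ^ n * (k + 1) - π) := by
  have harg : principalArg ((t : ℂ) * (Real.cos φ + Real.sin φ * Complex.I)) = φ := by
    have h := Complex.arg_mul_cos_add_sin_mul_I ht ⟨hφ.1, hφ.2.le⟩
    rw [principalArg, Complex.ofReal_cos, Complex.ofReal_sin, h, if_neg hφ.2.ne]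
  rw [quantRegion, mem_ofPred_eq, harg, mem_Ico]
  constructor <;> rintro ⟨h1, h2⟩ <;> constructor <;> linarith

/-- The likelihood is a window probability, the window being centred at the middle of the region. -/
theorem stdComplexGaussian_quantRegion {ρ : ℝ} (hρ : 0 ≤ ρ) (n : ℕ) (k : Fin (2 ^ n)) (ψ : ℝ) :
    stdComplexGaussian {w | (ρ : ℂ) * Complex.exp (Complex.I * ψ) + w ∈ quantRegion n k} =
      ENNReal.ofReal (window (π / 2 ^ n) ρ (2 * π / 2 ^ n * k - π + π / 2 ^ n - ψ)) := by
  have hp := Real.pi_pos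
  have hk : ((k : ℕ) : ℝ) + 1 ≤ 2 ^ n := by exact_mod_cast k.2
  have hδ : 0 < 2 * π / 2 ^ n := by positivity
  have hmul : 2 * π / 2 ^ n * (((k : ℕ) : ℝ) + 1) ≤ 2 * π := by
    calc 2 * π / 2 ^ n * (((k : ℕ) : ℝ) + 1) ≤ 2 * π / 2 ^ n * 2 ^ n := by gcongr
      _ = 2 * π := by field_simp
  have hk0 : 0 ≤ 2 * π / 2 ^ n * ((k : ℕ) : ℝ) := by positivity
  rw [stdComplexGaussian_cone_interval hρ ψ (a := 2 * π / 2 ^ n * k - π)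
    (b := 2 * π / 2 ^ n * (k + 1) - π) (by linarith) (by linarith) (by linarith)
    (measurableSet_quantRegion n k) measurableSet_Ico
    (fun t ht φ hφ => polar_mem_quantRegion_iff n k ht hφ) Ioo_subset_Ico_self Ico_subset_Icc_self]
  congr 1
  have h := intervalIntegral.integral_comp_add_right (a := -(π / 2 ^ n)) (b := π / 2 ^ n)
    (fun φ => phaseDensity ρ (Real.cos (φ - ψ))) (2 * π / 2 ^ n * k - π + π / 2 ^ n)
  rw [show -(π / 2 ^ n) + (2 * π / 2 ^ n * (k : ℝ) - π + π / 2 ^ n) = 2 * π / 2 ^ n * k - π by ring,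
    show π / 2 ^ n + (2 * π / 2 ^ n * (k : ℝ) - π + π / 2 ^ n) = 2 * π / 2 ^ n * (k + 1) - π by
      ring] at h
  rw [← h, window]
  congr 1
  ext φ
  ring_nf

/-- The mean over rotations of the largest likelihood. -/
theorem lintegral_iSup_likelihood {M n : ℕ} (hM : 0 < M) (snr : ℝ) (k : Fin (2 ^ n)) (h : ℂ) :
    ∫⁻ t : ℝ in Ioc 0 (2 * π), ⨆ j : Fin M,
        likelihood n snr k (Complex.exp (Complex.I * (t : ℂ)) * h) (pskPoint M j) =
      ENNReal.ofReal
        (M * ∫ t in (-(π / M))..(π / M), window (π / 2 ^ n) (Real.sqrt snr * ‖h‖) t) := by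
  have : Nonempty (Fin M) := ⟨⟨0, hM⟩⟩
  have hp := Real.pi_pos
  have hM' : (0 : ℝ) < M := by exact_mod_cast hM
  have hρ : 0 ≤ Real.sqrt snr * ‖h‖ := by positivity
  have hδπ : π / 2 ^ n ≤ π := div_le_self hp.le (one_le_pow₀ (by norm_num))
  have hF : ∀ α β, Real.cos β ≤ Real.cos α → window (π / 2 ^ n) (Real.sqrt snr * ‖h‖) β ≤
      window (π / 2 ^ n) (Real.sqrt snr * ‖h‖) α := fun α β =>
    window_le_window_of_cos_le (by positivity) hδπ hρ
  -- angle from the point with index `0`, before rotation, to the middle of the region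
  set c : ℝ := 2 * π / 2 ^ n * k + π / 2 ^ n - Complex.arg h - π / M with hc
  have hlik : ∀ (t : ℝ) (j : Fin M),
      likelihood n snr k (Complex.exp (Complex.I * (t : ℂ)) * h) (pskPoint M j) =
        ENNReal.ofReal
          (window (π / 2 ^ n) (Real.sqrt snr * ‖h‖) (c - t - 2 * π * (j : ℝ) / M)) := by
    intro t j
    have hz : (Real.sqrt snr : ℂ) * (Complex.exp (Complex.I * (t : ℂ)) * h) * pskPoint M j =
        ((Real.sqrt snr * ‖h‖ : ℝ) : ℂ) * Complex.exp (Complex.I *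
          ((t + Complex.arg h + π * ((2 * (j : ℝ) + 1) / (M : ℝ) - 1) : ℝ) : ℂ)) := by
      conv_lhs => rw [← Complex.norm_mul_exp_arg_mul_I h]
      rw [pskPoint]
      push_cast
      rw [mul_add, mul_add, Complex.exp_add, Complex.exp_add,
        mul_comm Complex.I (Complex.arg h : ℂ)]
      ring
    rw [likelihood, hz, stdComplexGaussian_quantRegion hρ]
    congr 2
    rw [hc]
    field_simp
    ring
  have hsup : ∀ t : ℝ, ⨆ j : Fin M,
      likelihood n snr k (Complex.exp (Complex.I * (t : ℂ)) * h) (pskPoint M j) =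
        ENNReal.ofReal (⨆ j : Fin M,
          window (π / 2 ^ n) (Real.sqrt snr * ‖h‖) (c - t - 2 * π * (j : ℝ) / M)) := by
    intro t
    simp_rw [hlik]
    refine le_antisymm (iSup_le fun j => ENNReal.ofReal_le_ofReal ?_) ?_
    · exact le_ciSup (f := fun j : Fin M => window (π / 2 ^ n) (Real.sqrt snr * ‖h‖)
        (c - t - 2 * π * (j : ℝ) / M)) (Set.finite_range _).bddAbove j
    · obtain ⟨j, hj⟩ := exists_eq_ciSup_of_finite (f := fun j : Fin M =>
        window (π / 2 ^ n) (Real.sqrt snr * ‖h‖) (c - t - 2 * π * (j : ℝ) / M))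
      rw [← hj]
      exact le_iSup (fun j : Fin M => ENNReal.ofReal (window (π / 2 ^ n) (Real.sqrt snr * ‖h‖)
        (c - t - 2 * π * (j : ℝ) / M))) j
  simp_rw [hsup]
  rw [← ofReal_integral_eq_lintegral_ofReal, ← intervalIntegral.integral_of_le (by positivity),
    integral_iSup_shift hF hM]
  · exact (intervalIntegrable_iSup_of_cos_le hF hM (fun j => by fun_prop) 0 (2 * π)).1
  · exact Filter.Eventually.of_forall fun t => Real.iSup_nonneg fun j =>
      window_nonneg (by positivity) _ _

/-! ### The error probability as a mean of sector probabilities -/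

/-- The probability that `ρ e^{iθ} + W` lies in the sector `(0, α)`. -/
def sectorProb (α ρ θ : ℝ) : ℝ :=
  stdComplexGaussian.real {w | (ρ : ℂ) * Complex.exp (Complex.I * θ) + w ∈ sector α}

theorem sectorProb_nonneg (α ρ θ : ℝ) : 0 ≤ sectorProb α ρ θ := measureReal_nonneg

theorem sectorProb_le_one (α ρ θ : ℝ) : sectorProb α ρ θ ≤ 1 := measureReal_le_one

theorem measurable_sectorProb (α σ : ℝ) :
    Measurable (Function.uncurry fun r θ => sectorProb α (σ * r) θ) := by
  have hm : MeasurableSet {x : (ℝ × ℝ) × ℂ |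
      ((σ * x.1.1 : ℝ) : ℂ) * Complex.exp (Complex.I * (x.1.2 : ℂ)) + x.2 ∈ sector α} :=
    (by fun_prop : Measurable fun x : (ℝ × ℝ) × ℂ =>
      ((σ * x.1.1 : ℝ) : ℂ) * Complex.exp (Complex.I * (x.1.2 : ℂ)) + x.2) (measurableSet_sector α)
  exact (measurable_measure_prodMk_left (ν := stdComplexGaussian) hm).ennreal_toReal

theorem measurable_one_sub_sectorProb (α σ : ℝ) :
    Measurable (Function.uncurry fun r θ => 1 - sectorProb α (σ * r) θ) :=
  measurable_const.sub (measurable_sectorProb α σ)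

theorem abs_one_sub_sectorProb_le_one (α ρ θ : ℝ) : |1 - sectorProb α ρ θ| ≤ 1 := by
  have h0 := sectorProb_nonneg α ρ θ
  have h1 := sectorProb_le_one α ρ θ
  exact abs_le.2 ⟨by linarith, by linarith⟩

section Detection

variable {Ω : Type*} [MeasurableSpace Ω] {μ : Measure Ω} [IsProbabilityMeasure μ]
  {M n : ℕ} {snr : ℝ} {X H W : Ω → ℂ}

/-- The probability of a correct decision: the mean, over the magnitude of the channel gain and
over the phase offset within the quantization region, of the probability that the received signal
lies in the decision sector. -/
theorem two_pi_mul_measure_eq_optimum (hM : 2 ≤ M) (hX : Measurable X) (hH : Measurable H)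
    (hW : Measurable W) (hindep : iIndepFun ![X, H, W] μ)
    (hXu : ∀ x ∈ pskConstellation M, μ {ω | X ω = x} = (M : ℝ≥0∞)⁻¹)
    (hWlaw : μ.map W = stdComplexGaussian) (hsymm : IsCircularlySymmetric μ H)
    {xhat : Fin (2 ^ n) → ℂ → ℂ} (hopt : IsOptimumDetector μ M n snr X H W xhat) :
    2 * π * μ.real {ω | X ω = xhat (quantizer n (received snr X H W ω)) (H ω)} =
      2 ^ n * ∫ r, (∫ θ in (π / M - π / 2 ^ n)..(π / M + π / 2 ^ n),
        sectorProb (2 * (π / M)) (Real.sqrt snr * r) θ) ∂(μ.map fun ω => ‖H ω‖) := by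
  have hp := Real.pi_pos
  have hM0 : 0 < M := by omega
  have hM' : (2 : ℝ) ≤ M := by exact_mod_cast hM
  have hMtop : (M : ℝ≥0∞) ≠ ∞ := ENNReal.natCast_ne_top M
  have hMne : (M : ℝ≥0∞) ≠ 0 := by exact_mod_cast hM0.ne'
  have hα : 2 * (π / M) ≤ π := by
    rw [← mul_div_assoc, div_le_iff₀ (by linarith)]; nlinarith
  set K : ℝ → ℝ := fun r => ∫ θ in (π / M - π / 2 ^ n)..(π / M + π / 2 ^ n),
        sectorProb (2 * (π / M)) (Real.sqrt snr * r) θ with hK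
  have hKm : Measurable K := measurable_intervalIntegral (measurable_sectorProb _ _) _ _
  have hab : π / M - π / 2 ^ n ≤ π / M + π / 2 ^ n := by
    have : 0 < π / 2 ^ n := by positivity
    linarith
  have hK0 : ∀ r, 0 ≤ K r := fun r =>
    intervalIntegral.integral_nonneg hab fun θ _ => sectorProb_nonneg _ _ _
  have hwin : ∀ h : ℂ, ∫ t in (-(π / M))..(π / M), window (π / 2 ^ n) (Real.sqrt snr * ‖h‖) t =
      K ‖h‖ := by
    intro h
    have hρ : 0 ≤ Real.sqrt snr * ‖h‖ := by positivity
    rw [integral_window_eq (by positivity) hρ]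
    refine intervalIntegral.integral_congr fun θ _ => ?_
    exact stdComplexGaussian_sector hρ (by positivity) hα θ
  have hk : ∀ k : Fin (2 ^ n), ENNReal.ofReal (2 * π) *
      ∫⁻ h, ⨆ j : Fin M, likelihood n snr k h (pskPoint M j) ∂(μ.map H) =
      M * ∫⁻ r, ENNReal.ofReal (K r) ∂(μ.map fun ω => ‖H ω‖) := by
    intro k
    rw [lintegral_map_of_circularlySymmetric hH hsymm
      (Measurable.iSup fun j => measurable_likelihood n snr k _)]
    simp_rw [lintegral_iSup_likelihood hM0 snr k, hwin,
      ENNReal.ofReal_mul (Nat.cast_nonneg M), ENNReal.ofReal_natCast]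
    rw [lintegral_const_mul' _ _ hMtop, lintegral_map (by fun_prop) hH,
      lintegral_map (by fun_prop) (by fun_prop)]
  have hmain : ENNReal.ofReal (2 * π) *
      μ {ω | X ω = xhat (quantizer n (received snr X H W ω)) (H ω)} =
      2 ^ n * ∫⁻ r, ENNReal.ofReal (K r) ∂(μ.map fun ω => ‖H ω‖) := by
    rw [measure_eq_optimum hM0 hX hH hW hindep hXu hWlaw hopt, mul_left_comm, Finset.mul_sum]
    simp_rw [hk]
    rw [Finset.sum_const, Finset.card_univ, Fintype.card_fin, nsmul_eq_mul, mul_left_comm,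
      ← mul_assoc (M : ℝ≥0∞)⁻¹, ENNReal.inv_mul_cancel hMne hMtop, one_mul]
    push_cast
    rfl
  have h := congrArg ENNReal.toReal hmain
  rw [ENNReal.toReal_mul, ENNReal.toReal_mul, ENNReal.toReal_ofReal (by positivity)] at h
  rw [Measure.real, h, integral_eq_lintegral_of_nonneg_ae (Filter.Eventually.of_forall hK0)
    hKm.aestronglyMeasurable]
  simp

/-- The two averages have total mass `1`, so the error probability is the same mean of the
probability of missing the sector. -/
theorem sep_eq_integral (hM : 2 ≤ M) (hX : Measurable X) (hH : Measurable H)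
    (hW : Measurable W) (hindep : iIndepFun ![X, H, W] μ)
    (hXu : ∀ x ∈ pskConstellation M, μ {ω | X ω = x} = (M : ℝ≥0∞)⁻¹)
    (hWlaw : μ.map W = stdComplexGaussian) (hsymm : IsCircularlySymmetric μ H)
    {xhat : Fin (2 ^ n) → ℂ → ℂ} (hopt : IsOptimumDetector μ M n snr X H W xhat) :
    sep μ n snr X H W xhat =
      2 ^ n / (2 * π) * ∫ r, (∫ θ in (π / M - π / 2 ^ n)..(π / M + π / 2 ^ n),
        (1 - sectorProb (2 * (π / M)) (Real.sqrt snr * r) θ)) ∂(μ.map fun ω => ‖H ω‖) := by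
  have hp := Real.pi_pos
  have : IsProbabilityMeasure (μ.map fun ω => ‖H ω‖) :=
    Measure.isProbabilityMeasure_map (by fun_prop)
  have hcorr := two_pi_mul_measure_eq_optimum hM hX hH hW hindep hXu hWlaw hsymm hopt
  have hS : Measurable (Function.uncurry fun r θ =>
      sectorProb (2 * (π / M)) (Real.sqrt snr * r) θ) := measurable_sectorProb _ _
  have hS1 : ∀ r θ, |sectorProb (2 * (π / M)) (Real.sqrt snr * r) θ| ≤ 1 := fun r θ => by
    rw [abs_of_nonneg (sectorProb_nonneg _ _ _)]; exact sectorProb_le_one _ _ _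
  have hadd := integral_intervalIntegral_add (ν := μ.map fun ω => ‖H ω‖)
    (f := fun r θ => 1 - sectorProb (2 * (π / M)) (Real.sqrt snr * r) θ) 
    (g := fun r θ => sectorProb (2 * (π / M)) (Real.sqrt snr * r) θ)
    (measurable_one_sub_sectorProb _ _) hS
    (fun _ _ => abs_one_sub_sectorProb_le_one _ _ _) hS1
    (π / M - π / 2 ^ n) (π / M + π / 2 ^ n)
  simp only [sub_add_cancel, intervalIntegral.integral_const, smul_eq_mul, mul_one,
    integral_const, probReal_univ, one_mul] at hadd
  have hg : Measurable fun q : Fin (2 ^ n) × ℂ => xhat q.1 q.2 :=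
    measurable_from_prod_countable_right hopt.measurable
  have hset : MeasurableSet {ω | X ω = xhat (quantizer n (received snr X H W ω)) (H ω)} :=
    measurableSet_eq_fun hX (hg.comp (measurable_observation hX hH hW))
  have hsep : sep μ n snr X H W xhat =
      1 - μ.real {ω | X ω = xhat (quantizer n (received snr X H W ω)) (H ω)} := by
    rw [← probReal_compl_eq_one_sub hset]
    rfl
  have hcomb : ∀ c A B : ℝ, 2 * π * c = 2 ^ n * B →
      π / M + π / 2 ^ n - (π / M - π / 2 ^ n) = A + B → 1 - c = 2 ^ n / (2 * π) * A := by
    intro c A B h1 h2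
    have hA : A = 2 * π / 2 ^ n - B := by linear_combination -h2
    have hc : c = 2 ^ n * B / (2 * π) := by rw [← h1]; field_simp
    rw [hA, hc]
    field_simp
  rw [hsep]
  exact hcomb _ _ _ hcorr hadd

end Detection

theorem measurable_uncurry_gaussianQ (σ : ℝ) {f : ℝ → ℝ} (hf : Measurable f) :
    Measurable (Function.uncurry fun r θ => gaussianQ (Real.sqrt 2 * (σ * r * f θ))) :=
  measurable_gaussianQ.comp
    (f := fun p : ℝ × ℝ => Real.sqrt 2 * (σ * p.1 * f p.2)) (by fun_prop)

theorem abs_gaussianQ_le_one (x : ℝ) : |gaussianQ x| ≤ 1 := by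
  rw [abs_of_nonneg (gaussianQ_nonneg _)]; exact gaussianQ_le_one _

/-- The mean of the probability of missing the quadrant. -/
theorem integral_quadrant_error {m σ : ℝ} [IsProbabilityMeasure (nakagamiMeasure m 1)]
    (hm : 0 < m) (hσ : 0 ≤ σ) {c d : ℝ} (hcd : c ≤ d) (hc : 0 ≤ c) (hd : d ≤ π / 2) :
    ∫ r, (∫ θ in c..d, (1 - sectorProb (π / 2) (σ * r) θ)) ∂nakagamiMeasure m 1 =
      (m ^ m / π * ∫ β in (0 : ℝ)..(π / 2), ∫ θ in c..d,
        (σ ^ 2 / Real.sin β ^ 2 * Real.cos θ ^ 2 + m) ^ (-m)) +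
      (m ^ m / π * ∫ β in (0 : ℝ)..(π / 2), ∫ θ in c..d,
        (σ ^ 2 / Real.sin β ^ 2 * Real.sin θ ^ 2 + m) ^ (-m)) -
      m ^ m / π ^ 2 * ∫ γ in (0 : ℝ)..(π / 2), ∫ β in (0 : ℝ)..(π / 2), ∫ θ in c..d,
        (σ ^ 2 * Real.cos θ ^ 2 / Real.sin β ^ 2 +
          σ ^ 2 * Real.sin θ ^ 2 / Real.sin γ ^ 2 + m) ^ (-m) := by
  have hp := Real.pi_pos
  have hcos : ∀ θ ∈ Icc c d, 0 ≤ Real.cos θ := fun θ hθ =>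
    Real.cos_nonneg_of_mem_Icc ⟨by linarith [hθ.1], by linarith [hθ.2]⟩
  have hsin : ∀ θ ∈ Icc c d, 0 ≤ Real.sin θ := fun θ hθ =>
    Real.sin_nonneg_of_nonneg_of_le_pi (by linarith [hθ.1]) (by linarith [hθ.2])
  have mc := measurable_uncurry_gaussianQ σ Real.measurable_cos
  have ms := measurable_uncurry_gaussianQ σ Real.measurable_sin
  have mcs : Measurable (Function.uncurry fun r θ =>
      gaussianQ (Real.sqrt 2 * (σ * r * Real.cos θ)) *
        gaussianQ (Real.sqrt 2 * (σ * r * Real.sin θ))) := mc.mul ms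
  rw [← integral_nakagami_gaussianQ hm hσ Real.measurable_cos hcd hcos,
    ← integral_nakagami_gaussianQ hm hσ Real.measurable_sin hcd hsin,
    ← integral_nakagami_gaussianQ_mul hm hσ Real.measurable_cos Real.measurable_sin hcd hcos hsin,
    ← integral_intervalIntegral_add mc ms (fun _ _ => abs_gaussianQ_le_one _)
      (fun _ _ => abs_gaussianQ_le_one _), eq_sub_iff_add_eq,
    ← integral_intervalIntegral_add (measurable_one_sub_sectorProb _ _) mcs
      (fun _ _ => abs_one_sub_sectorProb_le_one _ _ _) (D := 1)
      (fun r θ => by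
        rw [abs_mul]
        exact mul_le_one₀ (abs_gaussianQ_le_one _) (abs_nonneg _) (abs_gaussianQ_le_one _))]
  congr 1
  ext r
  congr 1
  ext θ
  rw [sectorProb, one_sub_sector_pi_div_two]
  ring

end PSKLink

end

open PSKLink in
theorem theorem3 {Ω : Type*} [MeasurableSpace Ω] (μ : Measure Ω) [IsProbabilityMeasure μ]
    (M n : ℕ) (hMpow : ∃ a : ℕ, M = 2 ^ a) (hM : 2 ≤ M) (hn : Real.logb 2 (M : ℝ) ≤ (n : ℝ))
    (m s snr : ℝ) (hm : 1 / 2 ≤ m) (hs : 0 < s) (hsnr : 0 ≤ snr)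
    (X H W : Ω → ℂ) (hXm : Measurable X) (hHm : Measurable H) (hWm : Measurable W)
    (hindep : iIndepFun ![X, H, W] μ)
    (hX : ∀ x ∈ PSKLink.pskConstellation M, μ {ω | X ω = x} = (M : ℝ≥0∞)⁻¹)
    (hW : μ.map W = PSKLink.stdComplexGaussian)
    (hHsymm : PSKLink.IsCircularlySymmetric μ H)
    (hHmag : μ.map (fun ω => ‖H ω‖) = PSKLink.nakagamiMeasure m s)
    (hHpow : ∫ ω, ‖H ω‖ ^ 2 ∂μ = 1)
    (xhat : Fin (2 ^ n) → ℂ → ℂ)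
    (hopt : PSKLink.IsOptimumDetector μ M n snr X H W xhat) :
    (4 ≤ M → PSKLink.sep μ n snr X H W xhat =
        PSKLink.p1 M n m snr + PSKLink.p2 M n m snr - PSKLink.p3 M n m snr
          + PSKLink.p4 M n m snr) ∧
      (M = 2 → PSKLink.sep μ n snr X H W xhat = PSKLink.p2 M n m snr) := by
  have hp := Real.pi_pos
  have hm0 : 0 < m := by linarith
  have hM' : (2 : ℝ) ≤ M := by exact_mod_cast hM
  have hσ := Real.sqrt_nonneg snr
  have hσ2 : Real.sqrt snr ^ 2 = snr := Real.sq_sqrt hsnr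
  -- unit power forces the spread parameter to be `1`
  have hs1 : s = 1 := by
    rw [← integral_sq_nakagamiMeasure hm0 hs, ← hHmag, integral_map (by fun_prop) (by fun_prop)]
    exact hHpow
  subst hs1
  have hprob : IsProbabilityMeasure (nakagamiMeasure m 1) := by
    rw [← hHmag]; exact Measure.isProbabilityMeasure_map (by fun_prop)
  have hM2n : (M : ℝ) ≤ 2 ^ n := by
    rw [← Real.rpow_natCast]
    exact (Real.logb_le_iff_le_rpow (by norm_num) (by linarith)).1 hn
  have hδ0 : 0 < π / 2 ^ n := by positivity
  have hδ : π / 2 ^ n ≤ π / M := div_le_div_of_nonneg_left hp.le (by linarith) hM2n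
  have hcd : π / M - π / 2 ^ n ≤ π / M + π / 2 ^ n := by linarith
  have hpow : (2 : ℝ) ^ ((n : ℝ) - 1) = 2 ^ n / 2 := by
    rw [Real.rpow_sub_one (by norm_num), Real.rpow_natCast]
  rw [sep_eq_integral hM hXm hHm hWm hindep hX hW hHsymm hopt, hHmag]
  refine ⟨fun hM4 => ?_, fun h2 => ?_⟩
  · have hM4' : (4 : ℝ) ≤ M := by exact_mod_cast hM4
    have hπM : π / M ≤ π / 4 := div_le_div_of_nonneg_left hp.le (by norm_num) hM4'
    have hquad := integral_quadrant_error hm0 hσ hcd (by linarith) (by linarith)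
    rw [hσ2] at hquad
    rcases hM4.eq_or_lt with h4 | h4
    · have hα : 2 * (π / M) = π / 2 := by rw [← h4]; push_cast; ring
      rw [hα, hquad, p1, p2, p3, p4, if_pos h4.symm, hpow]
      field_simp
      ring
    · have hM4'' : (4 : ℝ) < M := by exact_mod_cast h4
      have hα : 2 * (π / M) < π / 2 := by
        have : π / M < π / 4 := div_lt_div_of_pos_left hp (by norm_num) hM4''
        linarith
      have hα0 : 0 < 2 * (π / M) := by positivity
      have hcos := (Real.cos_pos_of_mem_Ioo (x := 2 * (π / M)) ⟨by linarith, hα⟩).ne'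
      have hwedge := integral_nakagami_wedge hm0 (Real.sqrt snr) hcos
        (π / M - π / 2 ^ n) (π / M + π / 2 ^ n)
      have hacute : ∀ r θ, 1 - sectorProb (2 * (π / M)) (Real.sqrt snr * r) θ =
          1 - sectorProb (π / 2) (Real.sqrt snr * r) θ + wedge (Real.tan (2 * (π / M)))
            (Real.sqrt snr * r * Real.cos θ) (Real.sqrt snr * r * Real.sin θ) := fun r θ => by
        rw [sectorProb, sectorProb, one_sub_sector_acute hα0 hα, one_sub_sector_pi_div_two]
      have halg : ∀ A B C D : ℝ, 2 ^ n / (2 * π) * (m ^ m / π * A + m ^ m / π * B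
            - m ^ m / π ^ 2 * C + 2 * m ^ m / (Real.sqrt π * Real.Gamma m) * D) =
          2 ^ n / 2 * m ^ m / π ^ 2 * A + 2 ^ n / 2 * m ^ m / π ^ 2 * B
            - 2 ^ n / 2 * m ^ m / π ^ 3 * C
            + 2 ^ n * m ^ m / (π * Real.sqrt π * Real.Gamma m) * D := by
        intro A B C D
        have := Real.Gamma_pos_of_pos hm0
        field_simp
      have hwm : Measurable (Function.uncurry fun r θ => wedge (Real.tan (2 * (π / M)))
          (Real.sqrt snr * r * Real.cos θ) (Real.sqrt snr * r * Real.sin θ)) :=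
        (measurable_wedge _).comp (f := fun x : ℝ × ℝ => (Real.sqrt snr * x.1 * Real.cos x.2,
            Real.sqrt snr * x.1 * Real.sin x.2)) (by fun_prop)
      simp_rw [hacute]
      rw [integral_intervalIntegral_add (measurable_one_sub_sectorProb _ _) hwm
          (fun _ _ => abs_one_sub_sectorProb_le_one _ _ _) (fun _ _ => abs_wedge_le_one _ _ _),
        hquad, hwedge, p1, p2, p3, p4, if_neg h4.ne', hpow, Real.sqrt_mul (by norm_num),
        mul_div_assoc 2 π (M : ℝ)]
      exact halg _ _ _ _
  · have hα : 2 * (π / M) = π := by rw [h2]; push_cast; ring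
    have hsin : ∀ θ ∈ Icc (π / M - π / 2 ^ n) (π / M + π / 2 ^ n), 0 ≤ Real.sin θ := fun θ hθ =>
      Real.sin_nonneg_of_nonneg_of_le_pi (by linarith [hθ.1]) (by linarith [hθ.2])
    simp_rw [hα, sectorProb, one_sub_sector_pi]
    rw [integral_nakagami_gaussianQ hm0 hσ Real.measurable_sin hcd hsin, p2, hpow, hσ2]
    field_simp
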